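/- **Theorem (PL Moser theorem).** Let $M$ be a connected compact PL $n$-manifold, possibly with boundary: a connected compact Hausdorff space with an atlas of charts onto open subsets of the half-space $H^n=\{x\in\mathbb{R}^n : x_1\ge 0\}$ (with $H^0=\mathbb{R}^0$) whose transition maps are piecewise linear homeomorphisms. A triangulation of $M$ is a PL homeomorphism $h:|K|\to M$ from the polyhedron of a finite simplicial complex $K$ in some Euclidean space. A Borel measure $\mu$ on $M$ is *simplicial relative to* the triangulation $h:|K|\to M$ if for each simplex $\sigma$ of $K$ there is a linear embedding (i.e. an injective affine map) $A_\sigma:\sigma\to\mathbb{R}^n$ such that $\mu(h(B))=\lambda^n(A_\sigma(B))$ for every Borel set $B\subseteq\sigma$, where $\lambda^n$ is Lebesgue measure on $\mathbb{R}^n$. It is *simplicial* if it is simplicial relative to some triangulation of $M$. 1. If $\mu_1$ and $\mu_2$ are simplicial measures on $M$ (possibly relative to different triangulations) with $\mu_1(M)=\mu_2(M)$, then there is a PL homeomorphism $f:M\to M$ with $f_*\mu_1=\mu_2$. 2. Every simplicial measure $\mu$ on $M$ is locally PL-Lebesgue: every point of $M$ lies in the domain $U$ of a chart $e:U\to H^n$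 of the PL structure (i.e. of the maximal PL atlas) such that $\mu(B)=\lambda^n(e(B))$ for every Borel set $B\subseteq U$. -/

import Mathlib

open Set Filter Topology MeasureTheory

/-- A (closed, possibly unbounded) convex polyhedron: a finite intersection of closed
half-spaces. -/
def IsConvexPolyhedron {E : Type*} [AddCommGroup E] [Module ℝ E] (P : Set E) : Prop :=
  ∃ S : Set (E →ᵃ[ℝ] ℝ), S.Finite ∧ P = {x | ∀ φ ∈ S, 0 ≤ φ x}

/-- Let `ι : X → E` be coordinates on a space `X`.  The map `f : X → F` is piecewise linear near
the point `x`, with respect to these coordinates, if some neighbourhood of `x` is covered by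
finitely many convex polyhedra on each of which `f` is given by an affine map. -/
def PLAt {X E F : Type*} [TopologicalSpace X] [AddCommGroup E] [Module ℝ E]
    [AddCommGroup F] [Module ℝ F] (ι : X → E) (f : X → F) (x : X) : Prop :=
  ∃ Q : Set (Set E × (E →ᵃ[ℝ] F)), Q.Finite ∧ (∀ q ∈ Q, IsConvexPolyhedron q.1) ∧
    ∀ᶠ y in 𝓝 x, (∃ q ∈ Q, ι y ∈ q.1) ∧ ∀ q ∈ Q, ι y ∈ q.1 → f y = q.2 (ι y)

section Helpers

variable {X E F G : Type*} [TopologicalSpace X] [AddCommGroup E] [Module ℝ E]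
  [AddCommGroup F] [Module ℝ F] [AddCommGroup G] [Module ℝ G]

theorem IsConvexPolyhedron.univ : IsConvexPolyhedron (Set.univ : Set E) :=
  ⟨∅, Set.finite_empty, by simp⟩

theorem IsConvexPolyhedron.inter {P Q : Set E} (hP : IsConvexPolyhedron P)
    (hQ : IsConvexPolyhedron Q) : IsConvexPolyhedron (P ∩ Q) := by
  obtain ⟨S, hS, rfl⟩ := hP
  obtain ⟨T, hT, rfl⟩ := hQ
  refine ⟨S ∪ T, hS.union hT, ?_⟩
  ext x
  simp only [mem_inter_iff, mem_ofPred_eq, mem_union]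
  exact ⟨fun h φ hφ => hφ.elim (h.1 φ) (h.2 φ),
    fun h => ⟨fun φ hφ => h φ (Or.inl hφ), fun φ hφ => h φ (Or.inr hφ)⟩⟩

theorem IsConvexPolyhedron.preimage {P : Set F} (hP : IsConvexPolyhedron P) (A : E →ᵃ[ℝ] F) :
    IsConvexPolyhedron (A ⁻¹' P) := by
  obtain ⟨S, hS, rfl⟩ := hP
  refine ⟨(fun φ : F →ᵃ[ℝ] ℝ => φ.comp A) '' S, hS.image _, ?_⟩
  ext x
  simp

theorem PLAt.self (ι : X → E) (x : X) : PLAt ι ι x :=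
  ⟨{(Set.univ, AffineMap.id ℝ E)}, Set.finite_singleton _, by
    rintro q rfl; exact IsConvexPolyhedron.univ, by simp⟩

theorem PLAt.congr {ι : X → E} {f g : X → F} {x : X} (hf : PLAt ι f x) (h : g =ᶠ[𝓝 x] f) :
    PLAt ι g x := by
  obtain ⟨Q, hQ, hP, hev⟩ := hf
  refine ⟨Q, hQ, hP, ?_⟩
  filter_upwards [hev, h] with y hy hgy
  exact ⟨hy.1, fun q hq hyq => hgy.trans (hy.2 q hq hyq)⟩

theorem PLAt.comp {Y : Type*} [TopologicalSpace Y] {ι : X → E} {κ : Y → F} {f : X → Y}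
    {g : Y → G} {x : X} (hg : PLAt κ g (f x)) (hf : PLAt ι (fun y => κ (f y)) x)
    (hc : ContinuousAt f x) : PLAt ι (fun y => g (f y)) x := by
  obtain ⟨Q, hQ, hQP, hQe⟩ := hf
  obtain ⟨R, hR, hRP, hRe⟩ := hg
  refine ⟨(fun p : (Set E × (E →ᵃ[ℝ] F)) × (Set F × (F →ᵃ[ℝ] G)) =>
    (p.1.1 ∩ p.1.2 ⁻¹' p.2.1, p.2.2.comp p.1.2)) '' (Q ×ˢ R), (hQ.prod hR).image _, ?_, ?_⟩
  · rintro _ ⟨⟨q, r⟩, ⟨hq, hr⟩, rfl⟩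
    exact (hQP q hq).inter ((hRP r hr).preimage q.2)
  · filter_upwards [hQe, hc.eventually hRe] with y hy hz
    refine ⟨?_, ?_⟩
    · obtain ⟨q, hq, hyq⟩ := hy.1
      obtain ⟨r, hr, hzr⟩ := hz.1
      refine ⟨_, ⟨(q, r), ⟨hq, hr⟩, rfl⟩, hyq, ?_⟩
      simpa [← hy.2 q hq hyq] using hzr
    · rintro _ ⟨⟨q, r⟩, ⟨hq, hr⟩, rfl⟩ ⟨hyq, hyr⟩
      have h1 := hy.2 q hq hyq
      have hyr' : κ (f y) ∈ r.1 := by rw [h1]; exact hyr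
      have h2 := hz.2 r hr hyr'
      simp only [AffineMap.comp_apply]
      rw [h2, h1]

end Helpers

theorem PLAt.continuousAt {X E F : Type*} [TopologicalSpace X] [NormedAddCommGroup E]
    [NormedSpace ℝ E] [FiniteDimensional ℝ E] [NormedAddCommGroup F] [NormedSpace ℝ F]
    {ι : X → E} {f : X → F} {x : X}
    (hf : PLAt ι f x) (hι : ContinuousAt ι x) : ContinuousAt f x := by
  obtain ⟨Q, hQ, hP, hev⟩ := hf
  intro U hU
  have hx := hev.self_of_nhds
  have key : ∀ᶠ y in 𝓝 x, ∀ q ∈ Q, ι y ∈ q.1 → q.2 (ι y) ∈ U := by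
    rw [Filter.eventually_all_finite hQ]
    intro q hq
    by_cases hxq : ι x ∈ q.1
    · have hA : ContinuousAt (fun y => q.2 (ι y)) x :=
        (q.2.continuous_of_finiteDimensional.continuousAt).comp hι
      have : U ∈ 𝓝 (q.2 (ι x)) := by rw [← hx.2 q hq hxq]; exact hU
      filter_upwards [hA this] with y hy _ using hy
    · have hcl : IsClosed q.1 := by
        obtain ⟨S, -, hS⟩ := hP q hq
        rw [hS]
        simp only [ofPred_forall]
        exact isClosed_iInter fun φ => isClosed_iInter fun _ =>
          isClosed_le continuous_const φ.continuous_of_finiteDimensional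
      filter_upwards [hι (hcl.isOpen_compl.mem_nhds hxq)] with y hy hyq
      exact absurd hyq hy
  change ∀ᶠ y in 𝓝 x, f y ∈ U
  filter_upwards [hev, key] with y hy hk
  obtain ⟨q, hq, hyq⟩ := hy.1
  rw [hy.2 q hq hyq]
  exact hk q hq hyq

/-- The closed half-space `{x | 0 ≤ x₀}` of `ℝⁿ`, the model of `n`-manifolds with (possibly empty)
boundary; in dimension `0` it is the point `ℝ⁰`. -/
def PLHalfSpace (n : ℕ) : Type :=
  {x : EuclideanSpace ℝ (Fin n) // ∀ i : Fin n, i.val = 0 → 0 ≤ x i}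

instance (n : ℕ) : TopologicalSpace (PLHalfSpace n) :=
  inferInstanceAs (TopologicalSpace (Subtype _))

/-- The inclusion of the half-space in `ℝⁿ`. -/
def PLHalfSpace.incl {n : ℕ} (x : PLHalfSpace n) : EuclideanSpace ℝ (Fin n) := x.1

theorem PLHalfSpace.isInducing_incl (n : ℕ) :
    IsInducing (PLHalfSpace.incl : PLHalfSpace n → EuclideanSpace ℝ (Fin n)) :=
  IsInducing.subtypeVal

theorem PLHalfSpace.continuousAt_of_PLAt {n : ℕ} {f : PLHalfSpace n → PLHalfSpace n}
    {x : PLHalfSpace n} (hf : PLAt PLHalfSpace.incl (fun y => (f y).incl) x) :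
    ContinuousAt f x :=
  (PLHalfSpace.isInducing_incl n).continuousAt_iff.2
    (hf.continuousAt (PLHalfSpace.isInducing_incl n).continuous.continuousAt)

/-- Piecewise linear maps between open subsets of the half-space. -/
def plPregroupoid (n : ℕ) : Pregroupoid (PLHalfSpace n) where
  property f u := ∀ x ∈ u, PLAt PLHalfSpace.incl (fun y => (f y).incl) x
  comp := by
    intro f g u v hf hg _ _ _ x hx
    exact (hg (f x) hx.2).comp (hf x hx.1) (PLHalfSpace.continuousAt_of_PLAt (hf x hx.1))
  id_mem := fun x _ => PLAt.self _ x
  locality := by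
    intro f u _ h x hx
    obtain ⟨v, _, hxv, hv⟩ := h x hx
    exact hv x ⟨hx, hxv⟩
  congr := by
    intro f g u hu hfg hf x hx
    refine (hf x hx).congr ?_
    filter_upwards [hu.mem_nhds hx] with y hy
    rw [hfg y hy]

/-- The groupoid of PL homeomorphisms between open subsets of the half-space: both the map and its
inverse are piecewise linear.  A PL `n`-manifold (with possibly empty boundary) is a Hausdorff,
second countable space with an atlas of charts in the half-space whose transition maps belong to
this groupoid. -/
def plGroupoid (n : ℕ) : StructureGroupoid (PLHalfSpace n) :=
  (plPregroupoid n).groupoid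

section Manifold

variable (n : ℕ) {M : Type*} [TopologicalSpace M] [ChartedSpace (PLHalfSpace n) M]

/-- The coordinates in `ℝⁿ` given by the preferred chart at `p`. Only their germ at `p` matters. -/
noncomputable def plCoord (p q : M) : EuclideanSpace ℝ (Fin n) :=
  (chartAt (PLHalfSpace n) p q).incl

/-- A self-homeomorphism of a PL manifold is a PL homeomorphism if it and its inverse are
piecewise linear in charts. -/
def IsPLHomeomorph (f : M ≃ₜ M) : Prop :=
  (∀ p, PLAt (plCoord n p) (fun q => plCoord n (f p) (f q)) p) ∧
    ∀ p, PLAt (plCoord n p) (fun q => plCoord n (f.symm p) (f.symm q)) p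

variable (M) in
/-- A (finite) triangulation of a compact PL manifold `M`: a PL homeomorphism from the polyhedron
of a finite simplicial complex in a Euclidean space onto `M`. -/
structure PLTriangulation where
  /-- the dimension of the ambient Euclidean space -/
  N : ℕ
  /-- the simplicial complex -/
  K : Geometry.SimplicialComplex ℝ (EuclideanSpace ℝ (Fin N))
  finite_faces : K.faces.Finite
  /-- the homeomorphism of its polyhedron with `M` -/
  homeo : K.space ≃ₜ M
  isPL : ∀ x : K.space,
    PLAt (fun y : K.space => (y : EuclideanSpace ℝ (Fin N)))
      (fun y => plCoord n (homeo x) (homeo y)) x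
  isPL_symm : ∀ p : M,
    PLAt (plCoord n p) (fun q => (homeo.symm q : EuclideanSpace ℝ (Fin N))) p

variable [MeasurableSpace M]

/-- The measure `μ` is simplicial relative to the triangulation `T` if on each simplex it is given
by a linear (i.e. injective affine) embedding of that simplex in Euclidean space `ℝⁿ`: the
`μ`-measure of a Borel subset of the simplex is the Lebesgue measure of its image.  On the
`n`-simplices this is a constant positive multiple of volume; simplices of lower dimension
are null. -/
def IsSimplicialRelTo (μ : Measure M) (T : PLTriangulation n M) : Prop :=
  ∀ s ∈ T.K.faces, ∃ A : EuclideanSpace ℝ (Fin T.N) →ᵃ[ℝ] EuclideanSpace ℝ (Fin n),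
    InjOn A (convexHull ℝ (s : Set (EuclideanSpace ℝ (Fin T.N)))) ∧
    ∀ B : Set T.K.space, MeasurableSet B →
      (∀ x ∈ B, (x : EuclideanSpace ℝ (Fin T.N)) ∈ convexHull ℝ (s : Set _)) →
      μ (T.homeo '' B) = volume ((fun x : T.K.space => A x) '' B)

/-- A measure is simplicial if it is simplicial relative to some triangulation. -/
def IsSimplicialMeasure (μ : Measure M) : Prop :=
  ∃ T : PLTriangulation n M, IsSimplicialRelTo n μ T

/-- A measure is locally PL-Lebesgue if around every point there is a chart of the PL structure
(the maximal PL atlas) which carries it to Lebesgue measure. -/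
def IsLocallyPLLebesgue (μ : Measure M) : Prop :=
  ∀ p : M, ∃ e ∈ (plGroupoid n).maximalAtlas M, p ∈ e.source ∧
    ∀ B : Set M, MeasurableSet B → B ⊆ e.source →
      μ B = volume ((fun q => (e q).incl) '' B)

end Manifold

/-! A simplicial measure need not stay simplicial under the moves of the proof, so the argument runs
in a larger class: measures that in charts have, near every point, a density constant on each of
finitely many convex polyhedra (`HasPLDensityAt`). This class is stable under PL changes of
coordinates, sums, scaling, and restriction to chart simplices and their complements. A simplicial
measure belongs to it, with densities `|det|` of affine maps, and is finite and positive on nonempty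
open sets.

The geometric core is `exists_flatten_bipyramid`. Let two simplices lie on opposite sides of a
common facet, with constant densities `a` and `b`. A volume-preserving shear of one side puts both
apexes on one line through the barycentre of the facet. Pushing along that line by a multiple of a
tent function then slides the facet and has constant Jacobian on each side. Choosing the multiple
well makes the density constant on the union; conjugating by the shear gives a PL homeomorphism
fixing everything outside it.

A simplex can be cut by repeated edge splittings until each piece lies in one polyhedron of a given
finite family (`splitting_induction`). Undoing the splittings one at a time, with the bipyramid
lemma at each step, flattens a positive piecewise constant density on the whole simplex
(`flattens_of_polyhedral`).

Both claims follow. Two measures agreeing off a chart simplex and giving it equal mass flatten to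
the same constant there, so a PL homeomorphism relates them. This exchange property passes from two
overlapping sets to their union, by way of an intermediate measure (`PLExchangeable.exists_of_le`),
and hence to all of a compact connected `M`. For the local statement, flatten near the point to `c`
times Lebesgue measure and rescale the chart by `c ^ (1/n)`. -/

open scoped NNReal ENNReal Pointwise

set_option linter.unusedSectionVars false

/-! ### Calculus of piecewise linear maps -/

section PLCalculus

variable {X E F G : Type*} [TopologicalSpace X] [AddCommGroup E] [Module ℝ E]
  [AddCommGroup F] [Module ℝ F] [AddCommGroup G] [Module ℝ G] {ι : X → E} {x : X}

theorem PLAt.affine (A : E →ᵃ[ℝ] F) : PLAt ι (fun y => A (ι y)) x :=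
  ⟨{(Set.univ, A)}, Set.finite_singleton _, by
    rintro q rfl; exact IsConvexPolyhedron.univ, by simp⟩

theorem PLAt.affine_comp {f : X → F} (hf : PLAt ι f x) (A : F →ᵃ[ℝ] G) :
    PLAt ι (fun y => A (f y)) x := by
  obtain ⟨Q, hQ, hP, hev⟩ := hf
  refine ⟨(fun q : Set E × (E →ᵃ[ℝ] F) => (q.1, A.comp q.2)) '' Q, hQ.image _, ?_, ?_⟩
  · rintro _ ⟨q, hq, rfl⟩
    exact hP q hq
  · filter_upwards [hev] with y hy
    constructor
    · obtain ⟨q, hq, hyq⟩ := hy.1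
      exact ⟨_, ⟨q, hq, rfl⟩, hyq⟩
    · rintro _ ⟨q, hq, rfl⟩ hyq
      simp [hy.2 q hq hyq]

theorem PLAt.prodMk {f : X → F} {g : X → G} (hf : PLAt ι f x) (hg : PLAt ι g x) :
    PLAt ι (fun y => (f y, g y)) x := by
  obtain ⟨Q, hQ, hQP, hQe⟩ := hf
  obtain ⟨R, hR, hRP, hRe⟩ := hg
  refine ⟨(fun p : (Set E × (E →ᵃ[ℝ] F)) × (Set E × (E →ᵃ[ℝ] G)) =>
    (p.1.1 ∩ p.2.1, p.1.2.prod p.2.2)) '' (Q ×ˢ R), (hQ.prod hR).image _, ?_, ?_⟩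
  · rintro _ ⟨⟨q, r⟩, ⟨hq, hr⟩, rfl⟩
    exact (hQP q hq).inter (hRP r hr)
  · filter_upwards [hQe, hRe] with y hy hz
    refine ⟨?_, ?_⟩
    · obtain ⟨q, hq, hyq⟩ := hy.1
      obtain ⟨r, hr, hzr⟩ := hz.1
      exact ⟨_, ⟨(q, r), ⟨hq, hr⟩, rfl⟩, hyq, hzr⟩
    · rintro _ ⟨⟨q, r⟩, ⟨hq, hr⟩, rfl⟩ ⟨hyq, hyr⟩
      simp [hy.2 q hq hyq, hz.2 r hr hyr]

theorem IsConvexPolyhedron.setOf_nonneg (φ : E →ᵃ[ℝ] ℝ) : IsConvexPolyhedron {x | 0 ≤ φ x} :=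
  ⟨{φ}, Set.finite_singleton _, by simp⟩

/-- Each piece is cut in two by the sign of its affine function. The closed halves overlap where
that function vanishes, and there the two formulas agree. Minima, and hence tent functions, are
built from this. -/
theorem PLAt.max_zero {f : X → ℝ} (hf : PLAt ι f x) : PLAt ι (fun y => max 0 (f y)) x := by
  obtain ⟨Q, hQ, hP, hev⟩ := hf
  refine ⟨(fun q : Set E × (E →ᵃ[ℝ] ℝ) => (q.1 ∩ {x | 0 ≤ q.2 x}, q.2)) '' Q ∪
    (fun q : Set E × (E →ᵃ[ℝ] ℝ) => (q.1 ∩ {x | 0 ≤ (-q.2) x}, AffineMap.const ℝ E 0)) '' Q,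
    (hQ.image _).union (hQ.image _), ?_, ?_⟩
  · rintro _ (⟨q, hq, rfl⟩ | ⟨q, hq, rfl⟩) <;>
      exact (hP q hq).inter (IsConvexPolyhedron.setOf_nonneg _)
  · filter_upwards [hev] with y hy
    constructor
    · obtain ⟨q, hq, hyq⟩ := hy.1
      rcases le_total 0 (q.2 (ι y)) with h | h
      · exact ⟨_, Or.inl ⟨q, hq, rfl⟩, hyq, h⟩
      · exact ⟨_, Or.inr ⟨q, hq, rfl⟩, hyq, by simpa using h⟩
    · rintro _ (⟨q, hq, rfl⟩ | ⟨q, hq, rfl⟩) ⟨hyq, h⟩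
      · simpa [hy.2 q hq hyq] using h
      · simpa [hy.2 q hq hyq] using h

theorem PLAt.add {f g : X → F} (hf : PLAt ι f x) (hg : PLAt ι g x) :
    PLAt ι (fun y => f y + g y) x :=
  (hf.prodMk hg).affine_comp (LinearMap.fst ℝ F F + LinearMap.snd ℝ F F).toAffineMap

theorem PLAt.sub {f g : X → F} (hf : PLAt ι f x) (hg : PLAt ι g x) :
    PLAt ι (fun y => f y - g y) x :=
  (hf.prodMk hg).affine_comp (LinearMap.fst ℝ F F - LinearMap.snd ℝ F F).toAffineMap

theorem PLAt.smul_const {f : X → ℝ} (hf : PLAt ι f x) (d : F) : PLAt ι (fun y => f y • d) x :=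
  hf.affine_comp (LinearMap.toSpanSingleton ℝ F d).toAffineMap

theorem PLAt.mul_const {f : X → ℝ} (hf : PLAt ι f x) (d : ℝ) : PLAt ι (fun y => f y * d) x :=
  hf.smul_const d

theorem PLAt.const_mul {f : X → ℝ} (hf : PLAt ι f x) (d : ℝ) : PLAt ι (fun y => d * f y) x := by
  simpa only [mul_comm d] using hf.mul_const d

theorem PLAt.inf {f g : X → ℝ} (hf : PLAt ι f x) (hg : PLAt ι g x) :
    PLAt ι (fun y => min (f y) (g y)) x := by
  have := hf.sub (hf.sub hg).max_zero
  refine this.congr (Eventually.of_forall fun y => ?_)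
  rcases le_total (f y) (g y) with h | h <;> simp [h]

theorem PLAt.finset_inf' {κ : Type*} (s : Finset κ) (hs : s.Nonempty) {f : κ → X → ℝ}
    (hf : ∀ i ∈ s, PLAt ι (f i) x) : PLAt ι (fun y => s.inf' hs (fun i => f i y)) x := by
  classical
  induction hs using Finset.Nonempty.cons_induction with
  | singleton a => simpa using hf a (by simp)
  | cons a s h hs ih =>
    simp only [Finset.inf'_cons hs]
    exact (hf a (by simp)).inf (ih fun i hi => hf i (by simp [hi]))

theorem PLAt.comp_id {f : X → F} {g : F → G} [TopologicalSpace F] (hg : PLAt id g (f x))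
    (hf : PLAt ι f x) (hc : ContinuousAt f x) : PLAt ι (fun y => g (f y)) x :=
  PLAt.comp (κ := id) hg hf hc

end PLCalculus

section PLHomeomorphism

variable {E : Type*} [NormedAddCommGroup E] [NormedSpace ℝ E]

/-- Piecewise linear homeomorphisms of a vector space. -/
def IsPLEquiv (g : E ≃ₜ E) : Prop :=
  (∀ x, PLAt (id : E → E) g x) ∧ ∀ x, PLAt (id : E → E) g.symm x

theorem IsPLEquiv.refl : IsPLEquiv (Homeomorph.refl E) :=
  ⟨fun x => PLAt.self _ x, fun x => PLAt.self _ x⟩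

theorem IsPLEquiv.symm {g : E ≃ₜ E} (hg : IsPLEquiv g) : IsPLEquiv g.symm :=
  ⟨hg.2, hg.1⟩

theorem IsPLEquiv.trans {g h : E ≃ₜ E} (hg : IsPLEquiv g) (hh : IsPLEquiv h) :
    IsPLEquiv (g.trans h) :=
  ⟨fun x => (hh.1 (g x)).comp_id (hg.1 x) g.continuous.continuousAt,
    fun x => (hg.2 (h.symm x)).comp_id (hh.2 x) h.symm.continuous.continuousAt⟩

theorem exists_homeomorph_of_plAt [FiniteDimensional ℝ E] {f g : E → E}
    (hf : ∀ x, PLAt (id : E → E) f x) (hg : ∀ x, PLAt (id : E → E) g x)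
    (hgf : ∀ x, g (f x) = x) (hfg : ∀ x, f (g x) = x) :
    ∃ h : E ≃ₜ E, IsPLEquiv h ∧ (∀ x, h x = f x) ∧ ∀ x, h.symm x = g x :=
  ⟨{ toFun := f
     invFun := g
     left_inv := hgf
     right_inv := hfg
     continuous_toFun := continuous_iff_continuousAt.2 fun x => (hf x).continuousAt continuousAt_id
     continuous_invFun :=
       continuous_iff_continuousAt.2 fun x => (hg x).continuousAt continuousAt_id },
    ⟨hf, hg⟩, fun _ => rfl, fun _ => rfl⟩

end PLHomeomorphism

/-! ### Maps that scale volume by a constant -/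

section Scaling

variable {E : Type*} [NormedAddCommGroup E] [NormedSpace ℝ E] [FiniteDimensional ℝ E]
  [MeasureSpace E] [BorelSpace E] [(volume : Measure E).IsAddHaarMeasure]

theorem volume_image_affineMap (A : E →ᵃ[ℝ] E) (C : Set E) :
    volume (A '' C) = ENNReal.ofReal |LinearMap.det A.linear| * volume C := by
  have : A '' C = (fun y => y + A 0) '' (A.linear '' C) := by
    rw [Set.image_image]
    refine Set.image_congr fun x _ => ?_
    have := A.map_vadd 0 x
    simpa using this
  rw [this, Set.image_add_right, measure_preimage_add_right, Measure.addHaar_image_linearMap]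

/-- The affine map `x ↦ x + f x • d`. -/
noncomputable def affineShift (f : E →ᵃ[ℝ] ℝ) (d : E) : E →ᵃ[ℝ] E :=
  AffineMap.id ℝ E + (LinearMap.toSpanSingleton ℝ E d).toAffineMap.comp f

@[simp]
theorem affineShift_apply (f : E →ᵃ[ℝ] ℝ) (d x : E) : affineShift f d x = x + f x • d := by
  simp [affineShift]

/-- The linear part is a rank-one perturbation of the identity. Hence the Jacobian of a shift
depends only on the slope of `f` along `d`; every scaling factor below is computed this way. -/
theorem det_affineShift (f : E →ᵃ[ℝ] ℝ) (d : E) :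
    LinearMap.det (affineShift f d).linear = 1 + f.linear d := by
  rw [← LinearMap.transvection.det]
  congr 1

/-- The map `g` multiplies the volume of subsets of `s` by `δ`. -/
def ScalesOn (g : E → E) (s : Set E) (δ : ℝ) : Prop :=
  ∀ C ⊆ s, MeasurableSet C → volume (g '' C) = ENNReal.ofReal δ * volume C

theorem ScalesOn.mono {g : E → E} {s t : Set E} {δ : ℝ} (h : ScalesOn g t δ) (hst : s ⊆ t) :
    ScalesOn g s δ :=
  fun C hC hm => h C (hC.trans hst) hm

theorem ScalesOn.of_affineMap {g : E → E} {s : Set E} {δ : ℝ} (A : E →ᵃ[ℝ] E)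
    (hg : ∀ x ∈ s, g x = A x) (hδ : |LinearMap.det A.linear| = δ) : ScalesOn g s δ := by
  intro C hC _
  rw [Set.image_congr (fun x hx => hg x (hC hx)), volume_image_affineMap, hδ]

theorem ScalesOn.union (g : E ≃ₜ E) {s t : Set E} {δ : ℝ} (hs : ScalesOn g s δ)
    (ht : ScalesOn g t δ) (hsm : MeasurableSet s) : ScalesOn g (s ∪ t) δ := by
  intro C hC hm
  have h1 := hs (C ∩ s) inter_subset_right (hm.inter hsm)
  have h2 := ht (C \ s) (fun x hx => (hC hx.1).resolve_left hx.2) (hm.diff hsm)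
  have e : g '' C = g '' (C ∩ s) ∪ g '' (C \ s) := by
    rw [← Set.image_union, Set.inter_union_sdiff]
  rw [e, measure_union, h1, h2, ← mul_add, measure_inter_add_sdiff C hsm]
  · exact (Set.disjoint_image_iff g.injective).2 (Set.disjoint_sdiff_right.mono_left
      Set.inter_subset_right)
  · exact g.measurableEmbedding.measurableSet_image.2 (hm.diff hsm)

theorem ScalesOn.biUnion {κ : Type*} (g : E ≃ₜ E) {δ : ℝ} (I : Finset κ) {s : κ → Set E}
    (hs : ∀ i ∈ I, ScalesOn g (s i) δ) (hsm : ∀ i ∈ I, MeasurableSet (s i)) :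
    ScalesOn g (⋃ i ∈ I, s i) δ := by
  classical
  induction I using Finset.induction_on with
  | empty =>
    intro C hC _
    have : C = ∅ := by simpa using hC
    simp [this]
  | insert a I ha ih =>
    rw [Finset.set_biUnion_insert]
    exact ScalesOn.union g (hs a (by simp)) (ih (fun i hi => hs i (by simp [hi]))
      fun i hi => hsm i (by simp [hi])) (hsm a (by simp))

theorem ScalesOn.comp {g : E → E} {h : E ≃ₜ E} {s t : Set E} {δ δ' : ℝ} (hh : ScalesOn h s δ)
    (hg : ScalesOn g t δ') (hst : MapsTo h s t) (hδ' : 0 ≤ δ') :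
    ScalesOn (fun x => g (h x)) s (δ' * δ) := by
  intro C hC hm
  rw [← Set.image_image, hg _ (by rintro _ ⟨x, hx, rfl⟩; exact hst (hC hx))
    (h.measurableEmbedding.measurableSet_image.2 hm), hh C hC hm, ENNReal.ofReal_mul hδ', mul_assoc]

theorem ScalesOn.symm {g : E ≃ₜ E} {s : Set E} {δ : ℝ} (hg : ScalesOn g s δ) (hδ : 0 < δ) :
    ScalesOn g.symm (g '' s) δ⁻¹ := by
  intro C hC hm
  have h1 := hg (g.symm '' C) (by
    rintro _ ⟨x, hx, rfl⟩
    obtain ⟨y, hy, rfl⟩ := hC hx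
    simpa using hy) (g.symm.measurableEmbedding.measurableSet_image.2 hm)
  rw [Set.image_image] at h1
  simp only [Homeomorph.apply_symm_apply, Set.image_id'] at h1
  rw [h1, ← mul_assoc, ← ENNReal.ofReal_mul (by positivity), inv_mul_cancel₀ hδ.ne']
  simp

/-- A homeomorphism that multiplies the volume of subsets of `s` by `δ` carries the restriction
of the volume to `s` to a multiple of the restriction of the volume to the image. -/
theorem ScalesOn.map_restrict {g : E ≃ₜ E} {s : Set E} {δ : ℝ} (hg : ScalesOn g s δ)
    (hs : MeasurableSet s) (hδ : 0 < δ) :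
    Measure.map g (volume.restrict s) =
      ENNReal.ofReal δ⁻¹ • volume.restrict (g '' s) := by
  ext C hC
  rw [Measure.map_apply g.continuous.measurable hC,
    Measure.restrict_apply (g.continuous.measurable hC), Measure.smul_apply,
    Measure.restrict_apply hC]
  have h1 := hg (g ⁻¹' C ∩ s) inter_subset_right ((g.continuous.measurable hC).inter hs)
  rw [Set.image_preimage_inter] at h1
  rw [h1, smul_eq_mul, ← mul_assoc, ← ENNReal.ofReal_mul (by positivity), inv_mul_cancel₀ hδ.ne']
  simp

theorem volume_setOf_affineMap_eq_zero (φ : E →ᵃ[ℝ] ℝ) {a : E} (ha : φ a ≠ 0) :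
    volume {x | φ x = 0} = 0 := by
  have h : ({x | φ x = 0} : Set E) = ((AffineSubspace.mk' (0 : ℝ) ⊥).comap φ : Set E) := by
    ext x
    simp [AffineSubspace.mem_mk']
  rw [h]
  refine Measure.addHaar_affineSubspace _ _ fun htop => ha ?_
  have : a ∈ (AffineSubspace.mk' (0 : ℝ) ⊥).comap φ := by rw [htop]; trivial
  simpa [AffineSubspace.mem_comap, AffineSubspace.mem_mk'] using this

end Scaling

/-- A nondegenerate simplex of full dimension in `E`, with its vertices and its barycentric
coordinates. -/
structure CoordSimplex (ι E : Type*) [Fintype ι] [AddCommGroup E] [Module ℝ E] where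
  /-- the vertices -/
  pt : ι → E
  /-- the barycentric coordinates -/
  coord : ι → E →ᵃ[ℝ] ℝ
  coord_self : ∀ i, coord i (pt i) = 1
  coord_ne : ∀ i j, i ≠ j → coord i (pt j) = 0
  sum_coord : ∀ x, ∑ i, coord i x = 1
  sum_smul : ∀ x, ∑ i, coord i x • pt i = x

/-! ### Barycentric coordinates -/

namespace CoordSimplex

section Algebra

variable {ι E : Type*} [Fintype ι] [AddCommGroup E] [Module ℝ E]

/-- The closed simplex. -/
def carrier (S : CoordSimplex ι E) : Set E := {x | ∀ i, 0 ≤ S.coord i x}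

theorem isConvexPolyhedron_carrier (S : CoordSimplex ι E) : IsConvexPolyhedron S.carrier :=
  ⟨Set.range S.coord, Set.finite_range _, by ext x; simp [carrier]⟩

theorem affine_sum_smul (S : CoordSimplex ι E) (φ : E →ᵃ[ℝ] ℝ) {c : ι → ℝ} (hc : ∑ i, c i = 1) :
    φ (∑ i, c i • S.pt i) = ∑ i, c i * φ (S.pt i) := by
  have h : ∀ y, φ y = φ.linear y + φ 0 := fun y => by
    have := φ.map_vadd 0 y
    simpa using this
  rw [h (∑ i, c i • S.pt i)]
  simp only [h (S.pt _), map_sum, mul_add, Finset.sum_add_distrib, ← Finset.sum_mul, hc, one_mul,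
    map_smul, smul_eq_mul]

theorem coord_sum_smul (S : CoordSimplex ι E) {c : ι → ℝ} (hc : ∑ i, c i = 1) (i : ι) :
    S.coord i (∑ j, c j • S.pt j) = c i := by
  rw [S.affine_sum_smul _ hc, Finset.sum_eq_single i
    (fun j _ hj => by rw [S.coord_ne i j hj.symm, mul_zero]) (by simp), S.coord_self, mul_one]

theorem affine_apply (S : CoordSimplex ι E) (φ : E →ᵃ[ℝ] ℝ) (x : E) :
    φ x = ∑ i, S.coord i x * φ (S.pt i) := by
  rw [← S.affine_sum_smul φ (S.sum_coord x), S.sum_smul]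

theorem linear_sub (φ : E →ᵃ[ℝ] ℝ) (x y : E) : φ.linear (x - y) = φ x - φ y := by
  simpa using φ.linearMap_vsub x y

end Algebra

section Topology

variable {ι E : Type*} [Fintype ι] [NormedAddCommGroup E] [NormedSpace ℝ E]

theorem isCompact_carrier (S : CoordSimplex ι E) : IsCompact S.carrier := by
  have h : S.carrier ⊆ (fun c : ι → ℝ => ∑ i, c i • S.pt i) '' stdSimplex ℝ ι :=
    fun x hx => ⟨fun i => S.coord i x, ⟨hx, S.sum_coord x⟩, S.sum_smul x⟩
  have h2 : S.carrier = (fun c : ι → ℝ => ∑ i, c i • S.pt i) '' stdSimplex ℝ ι := by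
    refine h.antisymm ?_
    rintro _ ⟨c, ⟨hc0, hc1⟩, rfl⟩ i
    simpa only [S.coord_sum_smul hc1] using hc0 i
  rw [h2]
  exact (isCompact_stdSimplex ℝ ι).image (by fun_prop)

end Topology

end CoordSimplex

/-! ### Tent shifts and bends -/

section Moves

variable {E : Type*} [NormedAddCommGroup E] [NormedSpace ℝ E] [FiniteDimensional ℝ E]

/-- Shifting in the direction `d` by a multiple of the tent function `max 0 (min p q)`, where `p`
and `q` vary linearly in the direction `d`. -/
theorem exists_tentShift {p q : E → ℝ} (hp : ∀ x, PLAt (id : E → E) p x)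
    (hq : ∀ x, PLAt (id : E → E) q x) {d : E} {ω κ : ℝ} (hω : 0 < ω) (hκ : κ < 1) (hκω : -ω < κ)
    (hpd : ∀ x r, p (x + r • d) = p x - r) (hqd : ∀ x r, q (x + r • d) = q x + r / ω) :
    ∃ g : E ≃ₜ E, IsPLEquiv g ∧ ∀ x, g x = x + (κ * max 0 (min (p x) (q x))) • d := by
  have h1 : 0 < 1 - κ := by linarith
  have h2 : 0 < 1 + κ / ω := by
    have : -1 < κ / ω := by rw [lt_div_iff₀ hω]; linarith
    linarith
  -- To invert the shift, the tent height must be recovered from the image point. With `a`, `b` the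
  -- old values of `p`, `q` and `m` the height, the new values are `a - κ * m` and `b + κ * m / ω`.
  -- Where `a` is the minimum the first is `(1 - κ) * a`, and where `b` is the minimum the second is
  -- `(1 + κ / ω) * b`; dividing by these positive factors restores `m`.
  have key : ∀ a b : ℝ, max 0 (min ((a - κ * max 0 (min a b)) * (1 - κ)⁻¹)
      ((b + κ * max 0 (min a b) / ω) * (1 + κ / ω)⁻¹)) = max 0 (min a b) := by
    intro a b
    rw [← div_eq_mul_inv, ← div_eq_mul_inv]
    rcases le_total (min a b) 0 with h | h
    · rw [max_eq_left h]
      simp only [mul_zero, sub_zero, zero_div, add_zero]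
      apply max_eq_left
      rcases min_le_iff.1 h with h | h
      · exact min_le_of_left_le (div_nonpos_of_nonpos_of_nonneg h h1.le)
      · exact min_le_of_right_le (div_nonpos_of_nonpos_of_nonneg h h2.le)
    · rw [max_eq_right h]
      rcases le_total a b with hab | hab
      · rw [min_eq_left hab] at h ⊢
        have e : (a - κ * a) / (1 - κ) = a := by field_simp
        rw [e, min_eq_left, max_eq_right h]
        rw [le_div_iff₀ h2]
        calc a * (1 + κ / ω) = a + κ * a / ω := by ring
          _ ≤ _ := by linarith
      · rw [min_eq_right hab] at h ⊢
        have e : (b + κ * b / ω) / (1 + κ / ω) = b := by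
          rw [div_eq_iff h2.ne']; ring
        rw [e, min_eq_right, max_eq_right h]
        rw [le_div_iff₀ h1]
        linarith
  -- The same recovery in the other order, with `a` and `b` the values at the target point.
  have key' : ∀ a b : ℝ, max 0 (min
      (a + κ * max 0 (min (a * (1 - κ)⁻¹) (b * (1 + κ / ω)⁻¹)))
      (b - κ * max 0 (min (a * (1 - κ)⁻¹) (b * (1 + κ / ω)⁻¹)) / ω)) =
      max 0 (min (a * (1 - κ)⁻¹) (b * (1 + κ / ω)⁻¹)) := by
    intro a b
    obtain ⟨a', rfl⟩ : ∃ a', a = a' * (1 - κ) := ⟨a / (1 - κ), by field_simp⟩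
    obtain ⟨b', rfl⟩ : ∃ b', b = b' * (1 + κ / ω) :=
      ⟨b / (1 + κ / ω), by rw [div_mul_cancel₀ _ h2.ne']⟩
    rw [mul_inv_cancel_right₀ h1.ne', mul_inv_cancel_right₀ h2.ne']
    rcases le_total (min a' b') 0 with h | h
    · rw [max_eq_left h]
      simp only [mul_zero, sub_zero, zero_div, add_zero]
      apply max_eq_left
      rcases min_le_iff.1 h with h | h
      · exact min_le_of_left_le (mul_nonpos_of_nonpos_of_nonneg h h1.le)
      · exact min_le_of_right_le (mul_nonpos_of_nonpos_of_nonneg h h2.le)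
    · rw [max_eq_right h]
      rcases le_total a' b' with hab | hab
      · rw [min_eq_left hab] at h ⊢
        have e : a' * (1 - κ) + κ * a' = a' := by ring
        rw [e, min_eq_left, max_eq_right h]
        have := mul_le_mul_of_nonneg_right hab h2.le
        have e2 : a' * (1 + κ / ω) = a' + κ * a' / ω := by ring
        linarith
      · rw [min_eq_right hab] at h ⊢
        have e : b' * (1 + κ / ω) - κ * b' / ω = b' := by ring
        rw [e, min_eq_right, max_eq_right h]
        have := mul_le_mul_of_nonneg_right hab h1.le
        linarith
  obtain ⟨g, hg, hgf, -⟩ := exists_homeomorph_of_plAt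
    (f := fun x => x + (κ * max 0 (min (p x) (q x))) • d)
    (g := fun x => x - (κ * max 0 (min (p x * (1 - κ)⁻¹) (q x * (1 + κ / ω)⁻¹))) • d)
    (fun x => (PLAt.self _ x).add ((((hp x).inf (hq x)).max_zero.const_mul κ).smul_const d))
    (fun x => (PLAt.self _ x).sub
      (((((hp x).mul_const _).inf ((hq x).mul_const _)).max_zero.const_mul κ).smul_const d))
    (fun x => by simp only [hpd, hqd, key, add_sub_cancel_right])
    (fun x => by
      simp only [sub_eq_add_neg, ← neg_smul, hpd, hqd, neg_neg, neg_div]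
      simp only [← sub_eq_add_neg (G := ℝ)]
      rw [key', add_assoc, ← add_smul]
      simp)
  exact ⟨g, hg, hgf⟩

/-- Bending along the hyperplane where the affine function `t` vanishes. -/
theorem exists_bend (t : E →ᵃ[ℝ] ℝ) {k : E} (hk : t.linear k = 0) :
    ∃ g : E ≃ₜ E, IsPLEquiv g ∧ ∀ x, g x = x + min (t x) 0 • k := by
  -- The shift amount is constant along the shift direction, so the opposite shift is the inverse.
  have ht : ∀ (x : E) (r : ℝ), t (x + r • k) = t x := fun x r => by
    have := t.map_vadd x (r • k)
    simpa [hk, add_comm] using this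
  have hpl : ∀ x, PLAt (id : E → E) (fun x => min (t x) 0) x := fun x =>
    (PLAt.affine t).inf (PLAt.affine (AffineMap.const ℝ E 0))
  obtain ⟨g, hg, hgf, -⟩ := exists_homeomorph_of_plAt
    (f := fun x => x + min (t x) 0 • k) (g := fun x => x - min (t x) 0 • k)
    (fun x => (PLAt.self _ x).add ((hpl x).smul_const k))
    (fun x => (PLAt.self _ x).sub ((hpl x).smul_const k))
    (fun x => by simp only [ht, add_sub_cancel_right])
    (fun x => by simp only [sub_eq_add_neg, ← neg_smul, ht]; simp)
  exact ⟨g, hg, hgf⟩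

variable [MeasureSpace E] [BorelSpace E] [(volume : Measure E).IsAddHaarMeasure]

theorem AffineMap.measurableSet_nonneg (φ : E →ᵃ[ℝ] ℝ) : MeasurableSet {x | 0 ≤ φ x} :=
  (isClosed_le continuous_const φ.continuous_of_finiteDimensional).measurableSet

theorem IsConvexPolyhedron.isClosed {P : Set E} (hP : IsConvexPolyhedron P) : IsClosed P := by
  obtain ⟨S, -, rfl⟩ := hP
  simp only [ofPred_forall]
  exact isClosed_iInter fun φ => isClosed_iInter fun _ =>
    isClosed_le continuous_const φ.continuous_of_finiteDimensional

/-- On one side the map is the identity, on the other a shear parallel to the hyperplane, of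
determinant 1. -/
theorem scalesOn_bend {t : E →ᵃ[ℝ] ℝ} {k : E} (hk : t.linear k = 0) {g : E ≃ₜ E}
    (hg : ∀ x, g x = x + min (t x) 0 • k) : ScalesOn g Set.univ 1 := by
  have h : (Set.univ : Set E) = {x | 0 ≤ t x} ∪ {x | 0 ≤ (-t) x} := by
    ext x
    simpa using le_total 0 (t x)
  rw [h]
  refine ScalesOn.union g ?_ ?_ t.measurableSet_nonneg
  · refine ScalesOn.of_affineMap (affineShift (AffineMap.const ℝ E 0) k) (fun x hx => ?_) ?_
    · rw [hg, min_eq_right hx]; simp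
    · rw [det_affineShift]; simp
  · refine ScalesOn.of_affineMap (affineShift t k) (fun x hx => ?_) ?_
    · rw [hg, min_eq_left (by simpa using hx)]; simp
    · rw [det_affineShift, hk]; simp

/-- A PL shift along `d` by a multiple of the minimum of finitely many affine functions which all
have slope `r` in the direction `d` scales volumes by a constant. -/
theorem scalesOn_inf'_shift {κ' : Type*} (I : Finset κ') (hI : I.Nonempty) (f : κ' → E →ᵃ[ℝ] ℝ)
    {d : E} {r κ : ℝ} (hf : ∀ i ∈ I, (f i).linear d = r) (hr : 0 ≤ 1 + κ * r) (g : E ≃ₜ E)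
    (s : Set E) (hs : MeasurableSet s)
    (hg : ∀ x ∈ s, g x = x + (κ * I.inf' hI fun i => f i x) • d) :
    ScalesOn g s (1 + κ * r) := by
  -- Cut `s` according to which `f i` attains the minimum. On each piece the shift is affine, and
  -- the common slope gives all pieces the same determinant.
  have hcov : s ⊆ ⋃ i ∈ I, s ∩ {x | ∀ j ∈ I, f i x ≤ f j x} := by
    intro x hx
    obtain ⟨i, hi, h⟩ := I.exists_mem_eq_inf' hI fun i => f i x
    refine mem_biUnion hi ⟨hx, fun j hj => ?_⟩
    rw [← h]
    exact I.inf'_le (fun i => f i x) hj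
  have hm : ∀ i ∈ I, MeasurableSet (s ∩ {x | ∀ j ∈ I, f i x ≤ f j x}) := by
    intro i _
    refine hs.inter (IsClosed.measurableSet ?_)
    simp only [ofPred_forall]
    exact isClosed_iInter fun j => isClosed_iInter fun _ =>
      isClosed_le (f i).continuous_of_finiteDimensional (f j).continuous_of_finiteDimensional
  refine (ScalesOn.biUnion g I (fun i hi => ?_) hm).mono hcov
  refine ScalesOn.of_affineMap (affineShift (κ • f i) d) (fun x hx => ?_) ?_
  · rw [hg x hx.1]
    have : (I.inf' hI fun i => f i x) = f i x :=
      le_antisymm (I.inf'_le (fun i => f i x) hi) (I.le_inf' hI _ hx.2)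
    simp [this]
  · rw [det_affineShift]
    simp [hf i hi, abs_of_nonneg hr]

end Moves

/-- The complement is mapped onto itself pointwise, so by bijectivity `s` is too. Supports of moves
are thus invariant. -/
theorem Homeomorph.image_eq_of_eq_off {X : Type*} [TopologicalSpace X] {g : X ≃ₜ X} {s : Set X}
    (hg : ∀ x ∉ s, g x = x) : g '' s = s := by
  have h : g '' sᶜ = sᶜ :=
    (Set.image_congr (g := id) fun x (hx : x ∈ sᶜ) => hg x hx).trans (Set.image_id _)
  rw [Set.image_compl_eq g.bijective] at h
  exact compl_injective h

theorem Homeomorph.symm_eq_off {X : Type*} [TopologicalSpace X] {g : X ≃ₜ X} {s : Set X}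
    (hg : ∀ x ∉ s, g x = x) : ∀ x ∉ s, g.symm x = x := fun x hx => by
  rw [Homeomorph.symm_apply_eq, hg x hx]

/-! ### Flattening two simplices with a common facet -/

namespace CoordSimplex

variable {ι E : Type*} [Fintype ι] [NormedAddCommGroup E] [NormedSpace ℝ E]
  [FiniteDimensional ℝ E]

theorem isClosed_carrier (S : CoordSimplex ι E) : IsClosed S.carrier := S.isCompact_carrier.isClosed

variable [MeasureSpace E] [BorelSpace E] [(volume : Measure E).IsAddHaarMeasure]

theorem measurableSet_carrier (S : CoordSimplex ι E) : MeasurableSet S.carrier :=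
  S.isClosed_carrier.measurableSet

theorem volume_setOf_coord_eq_zero (S : CoordSimplex ι E) (i : ι) :
    volume {x | S.coord i x = 0} = 0 :=
  volume_setOf_affineMap_eq_zero _ (a := S.pt i) (by simp [S.coord_self])

/-- Two simplices on opposite sides of a common facet: constant densities on them can be
redistributed to a constant density on their union by a PL homeomorphism fixing the complement. -/
theorem exists_flatten_bipyramid [Nontrivial ι] (S T : CoordSimplex ι E) (k : ι)
    (hF : ∀ l, l ≠ k → S.pt l = T.pt l) (hopp : S.coord k (T.pt k) < 0) {a b : ℝ} (ha : 0 < a)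
    (hb : 0 < b) :
    ∃ (c : ℝ) (g : E ≃ₜ E), 0 < c ∧ IsPLEquiv g ∧ (∀ x ∉ S.carrier ∪ T.carrier, g x = x) ∧
      volume (S.carrier ∩ T.carrier) = 0 ∧
      Measure.map g (ENNReal.ofReal a • volume.restrict S.carrier +
        ENNReal.ofReal b • volume.restrict T.carrier) =
      ENNReal.ofReal c • volume.restrict (S.carrier ∪ T.carrier) := by
  classical
  obtain ⟨l₀, hl₀⟩ := exists_ne k
  -- The height of the apex of `T` below the common facet, when that of `S` is at height 1. The
  -- simplices share a base, so `ω` is also their volume ratio.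
  set ω := -S.coord k (T.pt k) with hωdef
  have hω : 0 < ω := by linarith
  set F : Finset ι := Finset.univ.erase k with hFdef
  have hFne : F.Nonempty := ⟨l₀, by simp [hFdef, hl₀]⟩
  have hFm : ∀ l, l ∈ F ↔ l ≠ k := by simp [hFdef]
  set n : ℝ := (F.card : ℝ) with hn
  have hn0 : 0 < n := Nat.cast_pos.2 hFne.card_pos
  set w := T.pt k with hw
  -- `d` runs from the barycentre of the facet to the apex of `S`, and `e` is `1 / ω` times the
  -- vector from the apex of `T` to that barycentre. Both raise `t` at unit rate, so `d - e` is
  -- parallel to the facet, and bending by it takes the apex of `T` to the barycentre minus `ω • d`.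
  set d : E := n⁻¹ • ∑ j ∈ F, (S.pt k - S.pt j) with hd
  set e : E := (ω * n)⁻¹ • ∑ j ∈ F, (S.pt j - w) with he
  set t := S.coord k with ht
  -- slopes of the coordinates
  have slope_t : t.linear d = 1 := by
    rw [hd, map_smul, map_sum]
    rw [Finset.sum_congr rfl (fun j hj => by
      rw [linear_sub, ht, S.coord_self, S.coord_ne k j ((hFm j).1 hj).symm, sub_zero])]
    simp [← hn, hn0.ne']
  have slope_c : ∀ l ∈ F, (S.coord l).linear d = -n⁻¹ := by
    intro l hl
    rw [hd, map_smul, map_sum]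
    rw [Finset.sum_congr rfl (g := fun j => if j = l then (-1 : ℝ) else 0) (fun j hj => by
      rw [linear_sub, S.coord_ne l k ((hFm l).1 hl)]
      split_ifs with h
      · rw [h, S.coord_self]; norm_num
      · rw [S.coord_ne l j (Ne.symm h)]; norm_num)]
    simp [hl]
  have slope_te : t.linear e = 1 := by
    rw [he, map_smul, map_sum]
    rw [Finset.sum_congr rfl (fun j hj => by
      rw [linear_sub, ht, S.coord_ne k j ((hFm j).1 hj).symm, zero_sub])]
    simp only [Finset.sum_const, nsmul_eq_mul, smul_eq_mul, ← hn, ← ht, ← hωdef]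
    field_simp
  have slope_ce : ∀ l ∈ F, (S.coord l).linear e = (ω * n)⁻¹ * (1 - n * S.coord l w) := by
    intro l hl
    rw [he, map_smul, map_sum]
    rw [Finset.sum_congr rfl (g := fun j => (if j = l then (1 : ℝ) else 0) - S.coord l w)
      (fun j hj => by
        rw [linear_sub]
        split_ifs with h
        · rw [h, S.coord_self]
        · rw [S.coord_ne l j (Ne.symm h)])]
    simp [Finset.sum_sub_distrib, hl, hn]
  have hk : t.linear (d - e) = 0 := by rw [map_sub, slope_t, slope_te, sub_self]
  -- coordinates with respect to the second simplex
  have tT : ∀ x, t x = -ω * T.coord k x := by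
    intro x
    rw [T.affine_apply t x, Finset.sum_eq_single k (fun j _ hj => by
      rw [← hF j hj, ht, S.coord_ne k j hj.symm, mul_zero]) (by simp)]
    rw [hωdef]; ring
  have cT : ∀ l ∈ F, ∀ x, S.coord l x = T.coord l x + T.coord k x * S.coord l w := by
    intro l hl x
    have hlk := (hFm l).1 hl
    rw [T.affine_apply (S.coord l) x, Finset.sum_eq_add_of_mem l k (Finset.mem_univ _)
      (Finset.mem_univ _) hlk (fun j _ hj => by
        rw [← hF j hj.2, S.coord_ne l j hj.1.symm, mul_zero]),
      ← hF l hlk, S.coord_self, mul_one]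
  -- the two halves of the straightened bipyramid
  set f : ι → E →ᵃ[ℝ] ℝ := fun l => n • S.coord l with hf
  -- The multiple of `t` is forced: it turns the slope `-1` along `d` into `ω⁻¹`, and makes `f' l`
  -- on the bent `T` equal to `n` times the coordinate of `T` (see `f'T`).
  set f' : ι → E →ᵃ[ℝ] ℝ := fun l => n • S.coord l + (1 + ω⁻¹) • t with hf'
  have slope_f : ∀ l ∈ F, (f l).linear d = -1 := by
    intro l hl
    simp [hf, slope_c l hl, hn0.ne']
  have slope_f' : ∀ l ∈ F, (f' l).linear d = ω⁻¹ := by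
    intro l hl
    simp [hf', slope_c l hl, hn0.ne', slope_t]
  have shift : ∀ (φ : E →ᵃ[ℝ] ℝ) (x v : E) (r : ℝ), φ (x + r • v) = φ x + r * φ.linear v := by
    intro φ x v r
    have := φ.map_vadd x (r • v)
    simp only [vadd_eq_add, map_smul, smul_eq_mul] at this
    rw [add_comm x, this, add_comm]
  have f'T : ∀ l ∈ F, ∀ x, f' l (x + t x • (d - e)) = n * T.coord l x := by
    intro l hl x
    rw [shift]
    simp only [hf', AffineMap.coe_add, Pi.add_apply, AffineMap.coe_smul,
      Pi.smul_apply, smul_eq_mul, AffineMap.add_linear, AffineMap.smul_linear,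
      LinearMap.add_apply, LinearMap.smul_apply, map_sub, slope_c l hl, slope_ce l hl,
      slope_t, slope_te, cT l hl x, tT x]
    field_simp
    ring
  have inf'_add : ∀ (h : ι → ℝ) (r : ℝ), F.inf' hFne (fun i => h i + r) = F.inf' hFne h + r :=
    fun h r => (Finset.apply_inf'_eq_inf'_comp hFne (fun y => y + r)
      (fun x y => (min_add_add_right x y r).symm)).symm
  obtain ⟨θ, hθ, hθf⟩ := exists_bend t hk
  have hθ1 := scalesOn_bend hk hθf
  -- The average density, since the volumes are in ratio `1 : ω`. Then `κ` solves `1 - κ = a / c`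
  -- and `1 + κ / ω = b / c` simultaneously.
  set c : ℝ := (a + ω * b) / (1 + ω) with hc
  have hc0 : 0 < c := by positivity
  set κ : ℝ := 1 - a / c with hκdef
  have hκ1 : 1 + κ * (-1) = a / c := by rw [hκdef]; ring
  have hκ2 : 1 + κ * ω⁻¹ = b / c := by
    rw [hκdef, hc]
    field_simp
    ring
  have hκ : κ < 1 := by
    have : 0 < a / c := by positivity
    linarith
  have hκω : -ω < κ := by
    have h : 0 < b / c := by positivity
    rw [← hκ2] at h
    have : 0 < ω + κ := by
      have := mul_pos hω h
      rwa [mul_add, mul_one, mul_comm κ, mul_inv_cancel_left₀ hω.ne'] at this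
    linarith
  set p : E → ℝ := fun x => F.inf' hFne fun l => f l x with hp
  set q : E → ℝ := fun x => F.inf' hFne fun l => f' l x with hq
  have hpq : ∀ x, q x = p x + (1 + ω⁻¹) * t x := fun x => by
    rw [hp, ← inf'_add]
    rfl
  obtain ⟨Φ, hΦ, hΦf⟩ := exists_tentShift (p := p) (q := q) (d := d)
    (fun x => PLAt.finset_inf' _ _ fun l _ => PLAt.affine (f l))
    (fun x => PLAt.finset_inf' _ _ fun l _ => PLAt.affine (f' l)) hω hκ hκω
    (fun x r => by
      rw [hp, sub_eq_add_neg, ← inf'_add]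
      exact Finset.inf'_congr _ rfl fun l hl => by rw [shift, slope_f l hl]; ring)
    (fun x r => by
      rw [hq, div_eq_mul_inv, ← inf'_add]
      exact Finset.inf'_congr _ rfl fun l hl => by rw [shift, slope_f' l hl])
  have hθpos : ∀ x, 0 ≤ t x → θ x = x := fun x hx => by rw [hθf, min_eq_right hx]; simp
  have hθneg : ∀ x, t x ≤ 0 → θ x = x + t x • (d - e) := fun x hx => by
    rw [hθf, min_eq_left hx]
  have hθt : ∀ x, t (θ x) = t x := fun x => by rw [hθf, shift, hk, mul_zero, add_zero]
  have hS : ∀ x, x ∈ S.carrier ↔ 0 ≤ t x ∧ 0 ≤ p x := by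
    intro x
    simp only [hp, Finset.le_inf'_iff, hFm, carrier, mem_ofPred_eq, hf, AffineMap.coe_smul,
      Pi.smul_apply, smul_eq_mul, mul_nonneg_iff_of_pos_left hn0]
    exact ⟨fun h => ⟨h k, fun l _ => h l⟩, fun h i => (eq_or_ne i k).elim (fun e => e ▸ h.1) (h.2 i)⟩
  have hT : ∀ x, x ∈ T.carrier ↔ t x ≤ 0 ∧ 0 ≤ q (θ x) := by
    intro x
    have h1 : t x ≤ 0 ↔ 0 ≤ T.coord k x := by
      rw [tT, neg_mul, neg_nonpos, mul_nonneg_iff_of_pos_left hω]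
    have h2 : t x ≤ 0 → (0 ≤ q (θ x) ↔ ∀ l ∈ F, 0 ≤ T.coord l x) := by
      intro h
      rw [hθneg x h]
      simp only [hq, Finset.le_inf'_iff]
      refine forall₂_congr fun l hl => ?_
      rw [f'T l hl, mul_nonneg_iff_of_pos_left hn0]
    rw [and_congr_right h2, h1]
    simp only [hFm, carrier, mem_ofPred_eq]
    exact ⟨fun h => ⟨h k, fun l _ => h l⟩, fun h i => (eq_or_ne i k).elim (fun e => e ▸ h.1) (h.2 i)⟩
  have hω1 : 0 ≤ 1 + ω⁻¹ := by positivity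
  -- As `q - p = (1 + ω⁻¹) * t`, the tent equals `p` on the side of `S` and `q` on the side of the
  -- bent `T`.
  have hΦS : ScalesOn Φ S.carrier (a / c) := by
    rw [← hκ1]
    refine scalesOn_inf'_shift F hFne f slope_f (by rw [hκ1]; positivity) Φ _
      S.measurableSet_carrier fun x hx => ?_
    have h := (hS x).1 hx
    have h1 : p x ≤ q x := by
      rw [hpq]
      have := mul_nonneg hω1 h.1
      linarith
    rw [hΦf, min_eq_left h1, max_eq_right h.2]
  have hΦT : ScalesOn Φ (θ '' T.carrier) (b / c) := by
    rw [← hκ2]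
    refine scalesOn_inf'_shift F hFne f' slope_f' (by rw [hκ2]; positivity) Φ _
      (θ.measurableEmbedding.measurableSet_image.2 T.measurableSet_carrier) ?_
    rintro _ ⟨x, hx, rfl⟩
    have h := (hT x).1 hx
    have h1 : q (θ x) ≤ p (θ x) := by
      rw [hpq, hθt]
      have := mul_nonneg hω1 (neg_nonneg.2 h.1)
      linarith
    rw [hΦf, min_eq_right h1, max_eq_right h.2]
  have hθs : ScalesOn θ.symm Set.univ 1 := by
    have := hθ1.symm one_pos
    rwa [Set.image_univ_of_surjective θ.surjective, inv_one] at this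
  -- Straighten, push, bend back. Individually `S` and `T` are not preserved, because the facet
  -- between them moves; only their union is.
  set g : E ≃ₜ E := (θ.trans Φ).trans θ.symm with hg
  have hgS : ScalesOn g S.carrier (a / c) := by
    have h := ScalesOn.comp (h := θ) (hθ1.mono (subset_univ S.carrier)) hΦS
      (fun x hx => by rwa [hθpos x ((hS x).1 hx).1]) (by positivity)
    have := ScalesOn.comp (h := θ.trans Φ) h hθs (mapsTo_univ _ _) zero_le_one
    rwa [one_mul, mul_one] at this
  have hgT : ScalesOn g T.carrier (b / c) := by
    have h := ScalesOn.comp (h := θ) (hθ1.mono (subset_univ T.carrier)) hΦT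
      (mapsTo_image _ _) (by positivity)
    have := ScalesOn.comp (h := θ.trans Φ) h hθs (mapsTo_univ _ _) zero_le_one
    rwa [one_mul, mul_one] at this
  have hoff : ∀ x ∉ S.carrier ∪ T.carrier, g x = x := by
    intro x hx
    simp only [mem_union, hS, hT, not_or, not_and, not_le] at hx
    have hmin : min (p (θ x)) (q (θ x)) ≤ 0 := by
      rcases le_total 0 (t x) with h | h
      · rw [hθpos x h]
        exact min_le_of_left_le (hx.1 h).le
      · exact min_le_of_right_le (hx.2 h).le
    have : Φ (θ x) = θ x := by rw [hΦf, max_eq_left hmin]; simp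
    simp [hg, this]
  have hnull : volume (S.carrier ∩ T.carrier) = 0 :=
    measure_mono_null (fun x hx => le_antisymm ((hT x).1 hx.2).1 ((hS x).1 hx.1).1)
      (S.volume_setOf_coord_eq_zero k)
  refine ⟨c, g, hc0, (hθ.trans hΦ).trans hθ.symm, hoff, hnull, ?_⟩
  have hgm : Measurable g := g.continuous.measurable
  rw [Measure.map_add _ _ hgm, Measure.map_smul, Measure.map_smul,
    hgS.map_restrict S.measurableSet_carrier (by positivity),
    hgT.map_restrict T.measurableSet_carrier (by positivity), smul_smul, smul_smul,
    ← ENNReal.ofReal_mul ha.le, ← ENNReal.ofReal_mul hb.le, inv_div, inv_div,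
    mul_div_cancel₀ _ ha.ne', mul_div_cancel₀ _ hb.ne', ← smul_add,
    ← Measure.restrict_union₀, ← Set.image_union, Homeomorph.image_eq_of_eq_off hoff]
  · rw [AEDisjoint, ← Set.image_inter g.injective, hgS _ inter_subset_left
      (S.measurableSet_carrier.inter T.measurableSet_carrier), hnull, mul_zero]
  · exact (g.measurableEmbedding.measurableSet_image.2 T.measurableSet_carrier).nullMeasurableSet

end CoordSimplex

/-! ### Subdividing and flattening a simplex -/

namespace CoordSimplex

section Split

variable {ι E : Type*} [Fintype ι] [AddCommGroup E] [Module ℝ E]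

theorem nonempty_index (S : CoordSimplex ι E) : Nonempty ι := by
  by_contra h
  rw [not_nonempty_iff] at h
  simpa using S.sum_coord 0

theorem affine_edge (φ : E →ᵃ[ℝ] ℝ) (s : ℝ) (x y : E) :
    φ ((1 - s) • x + s • y) = (1 - s) * φ x + s * φ y := by
  have h : ∀ y, φ y = φ.linear y + φ 0 := fun y => by
    have := φ.map_vadd 0 y
    simpa using this
  rw [h, h x, h y]
  simp only [map_add, map_smul, smul_eq_mul]
  ring

theorem nonneg_of_mem_carrier (S : CoordSimplex ι E) {φ : E →ᵃ[ℝ] ℝ}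
    (h : ∀ i, 0 ≤ φ (S.pt i)) {x : E} (hx : x ∈ S.carrier) : 0 ≤ φ x := by
  rw [S.affine_apply φ x]
  exact Finset.sum_nonneg fun i _ => mul_nonneg (hx i) (h i)

/-- Renumbering of the vertices. -/
def reindex (S : CoordSimplex ι E) (σ : Equiv.Perm ι) : CoordSimplex ι E where
  pt i := S.pt (σ i)
  coord i := S.coord (σ i)
  coord_self i := S.coord_self _
  coord_ne i j h := S.coord_ne _ _ fun e => h (σ.injective e)
  sum_coord x := by rw [Equiv.sum_comp σ (fun i => S.coord i x), S.sum_coord]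
  sum_smul x := by rw [Equiv.sum_comp σ (fun i => S.coord i x • S.pt i), S.sum_smul]

theorem carrier_reindex (S : CoordSimplex ι E) (σ : Equiv.Perm ι) :
    (S.reindex σ).carrier = S.carrier := by
  ext x
  exact ⟨fun h i => by simpa [reindex] using h (σ.symm i), fun h i => h (σ i)⟩

variable [DecidableEq ι]

/-- The simplex obtained by moving the vertex `j` to an interior point of the edge `i j`. -/
noncomputable def split (S : CoordSimplex ι E) {i j : ι} (hij : i ≠ j) {s : ℝ} (hs : s ≠ 0) :
    CoordSimplex ι E where
  pt := Function.update S.pt j ((1 - s) • S.pt i + s • S.pt j)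
  coord := Function.update (Function.update S.coord i (S.coord i - ((1 - s) / s) • S.coord j)) j
    (s⁻¹ • S.coord j)
  coord_self l := by
    rcases eq_or_ne l j with rfl | hj
    · rw [Function.update_self, Function.update_self]
      simp [affine_edge, S.coord_ne l i hij.symm, S.coord_self, hs]
    · rw [Function.update_of_ne hj, Function.update_of_ne hj]
      rcases eq_or_ne l i with rfl | hi
      · simp [S.coord_self, S.coord_ne j l hj.symm]
      · rw [Function.update_of_ne hi, S.coord_self]
  coord_ne l m hlm := by
    rcases eq_or_ne l j with rfl | hj
    · rw [Function.update_self, Function.update_of_ne hlm.symm]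
      simp [S.coord_ne l m hlm]
    · rw [Function.update_of_ne hj]
      rcases eq_or_ne m j with rfl | hm
      · rw [Function.update_self]
        rcases eq_or_ne l i with rfl | hi
        · simp [affine_edge, S.coord_ne _ _ hlm, S.coord_ne _ _ hlm.symm, S.coord_self]
          field_simp
          ring
        · rw [Function.update_of_ne hi, affine_edge, S.coord_ne l i hi, S.coord_ne l m hlm]
          simp
      · rw [Function.update_of_ne hm]
        rcases eq_or_ne l i with rfl | hi
        · simp [S.coord_ne l m hlm, S.coord_ne j m hm.symm]
        · rw [Function.update_of_ne hi, S.coord_ne l m hlm]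
  sum_coord x := by
    have h := S.sum_coord x
    rw [← Finset.add_sum_erase _ _ (Finset.mem_univ j),
      ← Finset.add_sum_erase _ _ (Finset.mem_erase.2 ⟨hij, Finset.mem_univ i⟩)] at h ⊢
    rw [Finset.sum_congr rfl (g := fun l => S.coord l x) (fun l hl => by
      simp only [Finset.mem_erase] at hl
      rw [Function.update_of_ne hl.2.1, Function.update_of_ne hl.1])]
    conv_rhs => rw [← h]
    rw [Function.update_self, Function.update_of_ne hij, Function.update_self]
    simp only [AffineMap.coe_smul, AffineMap.coe_sub, Pi.smul_apply, Pi.sub_apply, smul_eq_mul]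
    field_simp
    ring
  sum_smul x := by
    have h := S.sum_smul x
    rw [← Finset.add_sum_erase _ _ (Finset.mem_univ j),
      ← Finset.add_sum_erase _ _ (Finset.mem_erase.2 ⟨hij, Finset.mem_univ i⟩)] at h ⊢
    rw [Finset.sum_congr rfl (g := fun l => S.coord l x • S.pt l) (fun l hl => by
      simp only [Finset.mem_erase] at hl
      rw [Function.update_of_ne hl.2.1, Function.update_of_ne hl.2.1, Function.update_of_ne hl.1])]
    conv_rhs => rw [← h]
    rw [Function.update_self, Function.update_self, Function.update_of_ne hij,
      Function.update_of_ne hij, Function.update_self]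
    simp only [AffineMap.coe_smul, AffineMap.coe_sub, Pi.smul_apply, Pi.sub_apply, smul_eq_mul]
    have e1 : s⁻¹ * S.coord j x * s = S.coord j x := by field_simp
    have e2 : (1 - s) / s * S.coord j x = s⁻¹ * S.coord j x * (1 - s) := by ring
    rw [smul_add, smul_smul, smul_smul, e1, e2]
    module

theorem split_pt_self (S : CoordSimplex ι E) {i j : ι} (hij : i ≠ j) {s : ℝ} (hs : s ≠ 0) :
    (S.split hij hs).pt j = (1 - s) • S.pt i + s • S.pt j :=
  Function.update_self ..

theorem split_pt_of_ne (S : CoordSimplex ι E) {i j l : ι} (hij : i ≠ j) {s : ℝ} (hs : s ≠ 0)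
    (hl : l ≠ j) : (S.split hij hs).pt l = S.pt l :=
  Function.update_of_ne hl ..

theorem carrier_eq_split_union (S : CoordSimplex ι E) {i j : ι} (hij : i ≠ j) {s : ℝ}
    (hs0 : 0 < s) (hs1 : 0 < 1 - s) :
    S.carrier = (S.split hij hs0.ne').carrier ∪ (S.split hij.symm hs1.ne').carrier := by
  -- The two halves are separated by the hyperplane `(1 - s) * coord j = s * coord i`, which passes
  -- through the new vertex and all vertices other than `i` and `j`.
  have key : ∀ {i j : ι} (hij : i ≠ j) {s : ℝ} (hs0 : 0 < s) (x : E),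
      x ∈ (S.split hij hs0.ne').carrier ↔
        (∀ l, l ≠ i → 0 ≤ S.coord l x) ∧ (1 - s) * S.coord j x ≤ s * S.coord i x := by
    intro i j hij s hs0 x
    have e : ∀ a b : ℝ, 0 ≤ a - (1 - s) / s * b ↔ (1 - s) * b ≤ s * a := by
      intro a b
      rw [sub_nonneg, div_mul_eq_mul_div, div_le_iff₀ hs0, mul_comm a]
    constructor
    · intro h
      refine ⟨fun l hl => ?_, ?_⟩
      · have := h l
        simp only [split] at this
        rcases eq_or_ne l j with rfl | hj
        · rw [Function.update_self] at this
          simpa [hs0] using this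
        · rwa [Function.update_of_ne hj, Function.update_of_ne hl] at this
      · have := h i
        simp only [split] at this
        rw [Function.update_of_ne hij, Function.update_self] at this
        exact (e _ _).1 this
    · rintro ⟨h1, h2⟩ l
      simp only [split]
      rcases eq_or_ne l j with rfl | hj
      · rw [Function.update_self]
        simpa [hs0] using h1 l hij.symm
      · rw [Function.update_of_ne hj]
        rcases eq_or_ne l i with rfl | hi
        · rw [Function.update_self]
          exact (e _ _).2 h2
        · rw [Function.update_of_ne hi]
          exact h1 l hi
  ext x
  rw [mem_union, key hij hs0, key hij.symm hs1, sub_sub_cancel]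
  constructor
  · intro h
    rcases le_total ((1 - s) * S.coord j x) (s * S.coord i x) with h' | h'
    · exact Or.inl ⟨fun l _ => h l, h'⟩
    · exact Or.inr ⟨fun l _ => h l, h'⟩
  · rintro (⟨h1, h2⟩ | ⟨h1, h2⟩) l
    · rcases eq_or_ne l i with rfl | hl
      · have := mul_nonneg hs1.le (h1 j hij.symm)
        exact nonneg_of_mul_nonneg_right (this.trans h2) hs0
      · exact h1 l hl
    · rcases eq_or_ne l j with rfl | hl
      · have := mul_nonneg hs0.le (h1 i hij)
        exact nonneg_of_mul_nonneg_right (this.trans h2) hs1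
      · exact h1 l hl

/-- Every simplex can be cut, by successive splittings at points of edges, into simplices on which
finitely many given affine functions do not change sign. -/
theorem splitting_induction (Φ : Set (E →ᵃ[ℝ] ℝ)) (hΦ : Φ.Finite) {p : CoordSimplex ι E → Prop}
    (S : CoordSimplex ι E)
    (hsplit : ∀ (T : CoordSimplex ι E) (i j : ι) (hij : i ≠ j) (s : ℝ) (hs0 : 0 < s)
      (hs1 : 0 < 1 - s), p (T.split hij hs0.ne') → p (T.split hij.symm hs1.ne') → p T)
    (hleaf : ∀ T : CoordSimplex ι E, T.carrier ⊆ S.carrier →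
      (∀ φ ∈ Φ, (∀ i, 0 ≤ φ (T.pt i)) ∨ ∀ i, φ (T.pt i) ≤ 0) → p T) : p S := by
  induction Φ, hΦ using Set.Finite.induction_on with
  | empty => exact hleaf S subset_rfl (by simp)
  | @insert φ Φ _ _ ih =>
    refine ih fun T hTS hT => ?_
    -- Induction on the number of vertices where `φ` does not vanish. If `φ` takes both signs, split
    -- an edge at its zero: in each half a vertex with `φ ≠ 0` is replaced by one with `φ = 0`.
    obtain ⟨N, hN⟩ : ∃ N, (Finset.univ.filter fun l => φ (T.pt l) ≠ 0).card = N := ⟨_, rfl⟩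
    induction N using Nat.strong_induction_on generalizing T with
    | _ N IH =>
      by_cases h : (∀ i, 0 ≤ φ (T.pt i)) ∨ ∀ i, φ (T.pt i) ≤ 0
      · exact hleaf T hTS fun ψ hψ => hψ.elim (fun e => e ▸ h) (hT ψ)
      push Not at h
      obtain ⟨⟨j, hj⟩, ⟨i, hi⟩⟩ := h
      have hij : i ≠ j := by rintro rfl; exact lt_asymm hi hj
      have hd : 0 < φ (T.pt i) - φ (T.pt j) := by linarith
      have hs0 : 0 < φ (T.pt i) / (φ (T.pt i) - φ (T.pt j)) := div_pos hi hd
      have hs1' : 1 - φ (T.pt i) / (φ (T.pt i) - φ (T.pt j)) =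
          -φ (T.pt j) / (φ (T.pt i) - φ (T.pt j)) := by field_simp; ring
      have hs1 : 0 < 1 - φ (T.pt i) / (φ (T.pt i) - φ (T.pt j)) := by
        rw [hs1']; exact div_pos (neg_pos.2 hj) hd
      set s := φ (T.pt i) / (φ (T.pt i) - φ (T.pt j)) with hs
      have hz : (1 - s) * φ (T.pt i) + s * φ (T.pt j) = 0 := by
        rw [hs1', hs]; field_simp; ring
      have hu := T.carrier_eq_split_union hij hs0 hs1
      have aux : ∀ {i j : ι} (hij : i ≠ j) {s : ℝ} (hs0 : 0 < s) (_ : 0 < 1 - s),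
          (1 - s) * φ (T.pt i) + s * φ (T.pt j) = 0 → φ (T.pt j) ≠ 0 →
          (T.split hij hs0.ne').carrier ⊆ S.carrier → p (T.split hij hs0.ne') := by
        intro i j hij s hs0 hs1 hz hj hsub
        refine IH _ ?_ (T.split hij hs0.ne') hsub (fun ψ hψ => ?_) rfl
        · rw [← hN]
          refine Finset.card_lt_card (Finset.ssubset_iff_of_subset ?_ |>.2 ⟨j, by simpa using hj, ?_⟩)
          · intro l hl
            simp only [Finset.mem_filter, Finset.mem_univ, true_and] at hl ⊢
            rcases eq_or_ne l j with rfl | hlj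
            · exact hj
            · rwa [split_pt_of_ne _ _ _ hlj] at hl
          · simp [split_pt_self, affine_edge, hz]
        -- The new vertex is a convex combination of old ones, so signs already arranged for other
        -- functions persist.
        · refine (hT ψ hψ).imp (fun h l => ?_) fun h l => ?_ <;>
          · rcases eq_or_ne l j with rfl | hlj
            · rw [split_pt_self, affine_edge]
              have h1 := h i
              have h2 := h l
              nlinarith [mul_nonneg hs0.le (abs_nonneg (ψ (T.pt l))), h1, h2]
            · rw [split_pt_of_ne _ _ _ hlj]
              exact h l
      refine hsplit T i j hij s hs0 hs1 (aux hij hs0 hs1 hz hj.ne ?_)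
        (aux hij.symm hs1 (by simpa using hs0) (by rw [← hz]; ring) hi.ne' ?_)
      · exact (hu ▸ subset_union_left).trans hTS
      · exact (hu ▸ subset_union_right).trans hTS

end Split

section Flatten

variable {ι E : Type*} [Fintype ι] [NormedAddCommGroup E] [NormedSpace ℝ E]
  [FiniteDimensional ℝ E] [MeasureSpace E] [BorelSpace E] [(volume : Measure E).IsAddHaarMeasure]

/-- The restriction of the measure `m` to `s` is carried to a multiple of the restricted volume by
a PL homeomorphism that fixes all points outside `s`. -/
def _root_.Flattens (m : Measure E) (s : Set E) : Prop :=
  ∃ (c : ℝ) (g : E ≃ₜ E), 0 < c ∧ IsPLEquiv g ∧ (∀ x ∉ s, g x = x) ∧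
    Measure.map g (m.restrict s) = ENNReal.ofReal c • volume.restrict s

/-- The map is the identity almost everywhere on `t`; flattening one simplex therefore leaves the
measure on its neighbour untouched. -/
theorem _root_.map_restrict_of_eq_off {m : Measure E} (hm : m ≪ volume) {g : E ≃ₜ E} {s t : Set E}
    (hg : ∀ x ∉ s, g x = x) (ht : MeasurableSet t) (hst : volume (s ∩ t) = 0) :
    Measure.map g (m.restrict t) = m.restrict t := by
  conv_rhs => rw [← Measure.map_id (μ := m.restrict t)]
  refine Measure.map_congr ?_
  rw [Filter.EventuallyEq, ae_restrict_iff' ht]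
  have h := hm hst
  rw [measure_eq_zero_iff_ae_notMem] at h
  filter_upwards [h] with x hx hxt
  exact hg x fun hxs => hx ⟨hxs, hxt⟩

/-- Flatten each simplex separately, which does not disturb the other because they meet in a null
set, and then equalise the two constants with the bipyramid move. -/
theorem flattens_of_adjacent [Nontrivial ι] {m : Measure E} (hm : m ≪ volume)
    (S T : CoordSimplex ι E) (k : ι) (hF : ∀ l, l ≠ k → S.pt l = T.pt l)
    (hopp : S.coord k (T.pt k) < 0) (hS : Flattens m S.carrier) (hT : Flattens m T.carrier) :
    Flattens m (S.carrier ∪ T.carrier) := by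
  obtain ⟨a, g₁, ha, hg₁, hoff₁, hmap₁⟩ := hS
  obtain ⟨b, g₂, hb, hg₂, hoff₂, hmap₂⟩ := hT
  obtain ⟨c, g, hc, hg, hoff, hnull, hmap⟩ := exists_flatten_bipyramid S T k hF hopp ha hb
  refine ⟨c, (g₁.trans g₂).trans g, hc, (hg₁.trans hg₂).trans hg, fun x hx => ?_, ?_⟩
  · simp only [Homeomorph.trans_apply]
    rw [hoff₁ x fun h => hx (Or.inl h), hoff₂ x fun h => hx (Or.inr h), hoff x hx]
  · have e : Measure.map g₂ (Measure.map g₁ (m.restrict (S.carrier ∪ T.carrier))) =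
        ENNReal.ofReal a • volume.restrict S.carrier +
          ENNReal.ofReal b • volume.restrict T.carrier := by
      rw [Measure.restrict_union₀ (hm hnull) T.measurableSet_carrier.nullMeasurableSet,
        Measure.map_add _ _ g₁.continuous.measurable, hmap₁,
        map_restrict_of_eq_off hm hoff₁ T.measurableSet_carrier hnull,
        Measure.map_add _ _ g₂.continuous.measurable, hmap₂, Measure.map_smul,
        map_restrict_of_eq_off Measure.AbsolutelyContinuous.rfl hoff₂ S.measurableSet_carrier
          (by rwa [inter_comm])]
    rw [← hmap, ← e, Measure.map_map g₂.continuous.measurable g₁.continuous.measurable,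
      Measure.map_map g.continuous.measurable
        (g₂.continuous.measurable.comp g₁.continuous.measurable)]
    rfl

theorem flattens_of_split [DecidableEq ι] {m : Measure E} (hm : m ≪ volume) (S : CoordSimplex ι E)
    {i j : ι} (hij : i ≠ j) {s : ℝ} (hs0 : 0 < s) (hs1 : 0 < 1 - s)
    (h1 : Flattens m (S.split hij hs0.ne').carrier)
    (h2 : Flattens m (S.split hij.symm hs1.ne').carrier) : Flattens m S.carrier := by
  have : Nontrivial ι := ⟨⟨i, j, hij⟩⟩
  rw [S.carrier_eq_split_union hij hs0 hs1]
  -- After the swap the halves have the same vertices except at index `i`, where the apexes are the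
  -- old `i` and `j`; the new vertex has index `j` in both.
  rw [← carrier_reindex (S.split hij.symm hs1.ne') (Equiv.swap i j)] at h2 ⊢
  refine flattens_of_adjacent hm _ _ i (fun l hl => ?_) ?_ h1 h2
  · simp only [reindex]
    rcases eq_or_ne l j with rfl | hlj
    · rw [Equiv.swap_apply_right, split_pt_self, split_pt_self, sub_sub_cancel, add_comm]
    · rw [Equiv.swap_apply_of_ne_of_ne hl hlj, split_pt_of_ne _ _ _ hlj, split_pt_of_ne _ _ _ hl]
  · simp only [reindex]
    rw [Equiv.swap_apply_left, split_pt_of_ne _ _ _ hij.symm]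
    simp only [split]
    rw [Function.update_of_ne hij, Function.update_self]
    simp [S.coord_ne i j hij, S.coord_self, div_pos hs1 hs0]

theorem exists_forall_coord_pos (S : CoordSimplex ι E) : ∃ x, ∀ i, 0 < S.coord i x := by
  have := S.nonempty_index
  have hN : (0 : ℝ) < Fintype.card ι := Nat.cast_pos.2 Fintype.card_pos
  refine ⟨∑ i, ((Fintype.card ι : ℝ)⁻¹) • S.pt i, fun i => ?_⟩
  rw [S.coord_sum_smul (c := fun _ => (Fintype.card ι : ℝ)⁻¹) (by simp)]
  positivity

theorem isOpen_setOf_coord_pos (S : CoordSimplex ι E) : IsOpen {x | ∀ i, 0 < S.coord i x} := by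
  simp only [ofPred_forall]
  exact isOpen_iInter_of_finite fun i =>
    isOpen_lt continuous_const (S.coord i).continuous_of_finiteDimensional

/-- A measure on a simplex which has a positive, piecewise constant density with respect to
finitely many convex polyhedra can be carried to a constant density. -/
theorem flattens_of_polyhedral (S : CoordSimplex ι E) {m : Measure E}
    {Q : Set (Set E × ℝ≥0)} (hQ : Q.Finite) (hP : ∀ q ∈ Q, IsConvexPolyhedron q.1)
    (hcov : ∀ x ∈ S.carrier, ∃ q ∈ Q, x ∈ q.1)
    (hdens : ∀ q ∈ Q, ∀ C, MeasurableSet C → C ⊆ S.carrier → C ⊆ q.1 → m C = q.2 * volume C)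
    (hpos : ∀ U, IsOpen U → U.Nonempty → U ⊆ S.carrier → m U ≠ 0) : Flattens m S.carrier := by
  classical
  have hac : m.restrict S.carrier ≪ volume := by
    refine Measure.AbsolutelyContinuous.mk fun C hC h0 => ?_
    rw [Measure.restrict_apply hC]
    have : C ∩ S.carrier ⊆ ⋃ q ∈ Q, C ∩ S.carrier ∩ q.1 := fun x hx => by
      obtain ⟨q, hq, hxq⟩ := hcov x hx.2
      exact mem_biUnion hq ⟨hx, hxq⟩
    refine measure_mono_null this ((measure_biUnion_null_iff hQ.countable).2 fun q hq => ?_)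
    rw [hdens q hq _ ((hC.inter S.measurableSet_carrier).inter (hP q hq).isClosed.measurableSet)
      (fun x hx => hx.1.2) inter_subset_right,
      measure_mono_null (fun x hx => hx.1.1) h0, mul_zero]
  choose! F hF hFP using hP
  suffices h : Flattens (m.restrict S.carrier) S.carrier by
    simpa only [Flattens, Measure.restrict_restrict S.measurableSet_carrier, inter_self] using h
  refine splitting_induction (⋃ q ∈ Q, F q) (hQ.biUnion hF)
    (p := fun T => Flattens (m.restrict S.carrier) T.carrier) S
    (fun T i j hij s hs0 hs1 => flattens_of_split hac T hij hs0 hs1) fun T hTS hT => ?_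
  obtain ⟨x, hx⟩ := T.exists_forall_coord_pos
  obtain ⟨q, hq, hxq⟩ := hcov x (hTS fun i => (hx i).le)
  -- Some polyhedron contains an interior point `x` of `T`. A defining function that is nonpositive
  -- at all vertices yet nonnegative at `x` must vanish at every vertex, so in all cases `T` lies in
  -- the polyhedron.
  have hTq : T.carrier ⊆ q.1 := by
    rw [hFP q hq] at hxq ⊢
    intro y hy φ hφ
    refine T.nonneg_of_mem_carrier ?_ hy
    refine (hT φ (mem_biUnion hq hφ)).elim id fun h => ?_
    have h0 := hxq φ hφ
    rw [T.affine_apply φ x] at h0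
    have h1 : ∀ i ∈ Finset.univ, T.coord i x * φ (T.pt i) ≤ 0 := fun i _ =>
      mul_nonpos_of_nonneg_of_nonpos (hx i).le (h i)
    have h2 := (Finset.sum_eq_zero_iff_of_nonpos h1).1 (le_antisymm (Finset.sum_nonpos h1) h0)
    intro i
    exact ((mul_eq_zero.1 (h2 i (Finset.mem_univ i))).resolve_left (hx i).ne').ge
  have hq0 : q.2 ≠ 0 := by
    intro h0
    have hU : {x | ∀ i, 0 < T.coord i x} ⊆ T.carrier := fun y hy i => (hy i).le
    refine hpos _ T.isOpen_setOf_coord_pos ⟨x, hx⟩ (hU.trans hTS) ?_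
    rw [hdens q hq _ T.isOpen_setOf_coord_pos.measurableSet (hU.trans hTS) (hU.trans hTq), h0]
    simp
  refine ⟨q.2, Homeomorph.refl E, NNReal.coe_pos.2 (pos_iff_ne_zero.2 hq0), IsPLEquiv.refl,
    fun _ _ => rfl, ?_⟩
  ext C hC
  have hCT := hC.inter T.measurableSet_carrier
  rw [Homeomorph.refl, Measure.restrict_restrict T.measurableSet_carrier,
    inter_eq_left.2 hTS]
  change Measure.map id _ C = _
  rw [Measure.map_id, Measure.restrict_apply hC, Measure.smul_apply, Measure.restrict_apply hC,
    hdens q hq _ hCT (inter_subset_right.trans hTS) (inter_subset_right.trans hTq)]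
  simp

end Flatten

end CoordSimplex

/-! ### Piecewise constant densities -/

section Density

variable {X E F : Type*} [TopologicalSpace X] [MeasurableSpace X]
  [NormedAddCommGroup E] [NormedSpace ℝ E] [FiniteDimensional ℝ E] [MeasureSpace E] [BorelSpace E]
  [(volume : Measure E).IsAddHaarMeasure] {ι ι' : X → E} {μ ν : Measure X} {x : X}

/-- With respect to the coordinates `ι`, the measure `μ` has near `x` a density that is constant on
each of finitely many convex polyhedra. -/
def HasPLDensityAt (ι : X → E) (μ : Measure X) (x : X) : Prop :=
  ∃ Q : Set (Set E × ℝ≥0), Q.Finite ∧ (∀ q ∈ Q, IsConvexPolyhedron q.1) ∧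
    ∃ U ∈ 𝓝 x, (∀ y ∈ U, ∃ q ∈ Q, ι y ∈ q.1) ∧ ∀ q ∈ Q, ∀ B, MeasurableSet B → B ⊆ U →
      (∀ y ∈ B, ι y ∈ q.1) → μ B = q.2 * volume (ι '' B)

/-- Refine the polyhedra so that the coordinate change is affine on each; the density is then
multiplied by the absolute determinant there. A degenerate piece simply gets density 0. -/
theorem HasPLDensityAt.change_coord (h : HasPLDensityAt ι μ x) (hι : PLAt ι' ι x) :
    HasPLDensityAt ι' μ x := by
  obtain ⟨Q, hQ, hQP, U, hU, hUQ, hd⟩ := h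
  obtain ⟨R, hR, hRP, hRe⟩ := hι
  obtain ⟨W, hW, hWR⟩ := hRe.exists_mem
  refine ⟨(fun p : (Set E × ℝ≥0) × (Set E × (E →ᵃ[ℝ] E)) =>
    (p.2.1 ∩ p.2.2 ⁻¹' p.1.1, p.1.2 * (|LinearMap.det p.2.2.linear|).toNNReal)) '' (Q ×ˢ R),
    (hQ.prod hR).image _, ?_, U ∩ W, inter_mem hU hW, fun y hy => ?_, ?_⟩
  · rintro _ ⟨⟨q, r⟩, ⟨hq, hr⟩, rfl⟩
    exact (hRP r hr).inter ((hQP q hq).preimage r.2)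
  · obtain ⟨q, hq, hyq⟩ := hUQ y hy.1
    obtain ⟨⟨r, hr, hyr⟩, h2⟩ := hWR y hy.2
    refine ⟨_, ⟨(q, r), ⟨hq, hr⟩, rfl⟩, hyr, ?_⟩
    rw [mem_preimage, ← h2 r hr hyr]
    exact hyq
  · rintro _ ⟨⟨q, r⟩, ⟨hq, hr⟩, rfl⟩ B hB hBU hBP
    have e : ∀ y ∈ B, ι y = r.2 (ι' y) := fun y hy => (hWR y (hBU hy).2).2 r hr (hBP y hy).1
    have e2 : ι '' B = r.2 '' (ι' '' B) := by
      rw [Set.image_image]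
      exact Set.image_congr e
    rw [hd q hq B hB (hBU.trans inter_subset_left) (fun y hy => by rw [e y hy]; exact (hBP y hy).2),
      e2, volume_image_affineMap, ← mul_assoc, ENNReal.coe_mul]
    rfl

theorem HasPLDensityAt.congr_measure (h : HasPLDensityAt ι μ x) {V : Set X} (hV : V ∈ 𝓝 x)
    (hμν : ∀ B ⊆ V, MeasurableSet B → ν B = μ B) : HasPLDensityAt ι ν x := by
  obtain ⟨Q, hQ, hQP, U, hU, hUQ, hd⟩ := h
  exact ⟨Q, hQ, hQP, U ∩ V, inter_mem hU hV, fun y hy => hUQ y hy.1, fun q hq B hB hBU hBP => by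
    rw [hμν B (hBU.trans inter_subset_right) hB]
    exact hd q hq B hB (hBU.trans inter_subset_left) hBP⟩

theorem HasPLDensityAt.zero : HasPLDensityAt ι (0 : Measure X) x :=
  ⟨{(univ, 0)}, Set.finite_singleton _, by rintro q rfl; exact IsConvexPolyhedron.univ, univ,
    univ_mem, by simp, by simp⟩

theorem HasPLDensityAt.add (hμ : HasPLDensityAt ι μ x) (hν : HasPLDensityAt ι ν x) :
    HasPLDensityAt ι (μ + ν) x := by
  obtain ⟨Q, hQ, hQP, U, hU, hUQ, hd⟩ := hμ
  obtain ⟨R, hR, hRP, W, hW, hWR, hd'⟩ := hν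
  refine ⟨(fun p : (Set E × ℝ≥0) × (Set E × ℝ≥0) => (p.1.1 ∩ p.2.1, p.1.2 + p.2.2)) '' (Q ×ˢ R),
    (hQ.prod hR).image _, ?_, U ∩ W, inter_mem hU hW, fun y hy => ?_, ?_⟩
  · rintro _ ⟨⟨q, r⟩, ⟨hq, hr⟩, rfl⟩
    exact (hQP q hq).inter (hRP r hr)
  · obtain ⟨q, hq, hyq⟩ := hUQ y hy.1
    obtain ⟨r, hr, hyr⟩ := hWR y hy.2
    exact ⟨_, ⟨(q, r), ⟨hq, hr⟩, rfl⟩, hyq, hyr⟩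
  · rintro _ ⟨⟨q, r⟩, ⟨hq, hr⟩, rfl⟩ B hB hBU hBP
    rw [Measure.add_apply, hd q hq B hB (hBU.trans inter_subset_left) fun y hy => (hBP y hy).1,
      hd' r hr B hB (hBU.trans inter_subset_right) fun y hy => (hBP y hy).2, ENNReal.coe_add,
      add_mul]

theorem HasPLDensityAt.smul (hμ : HasPLDensityAt ι μ x) (c : ℝ≥0) :
    HasPLDensityAt ι (c • μ) x := by
  obtain ⟨Q, hQ, hQP, U, hU, hUQ, hd⟩ := hμ
  refine ⟨(fun q : Set E × ℝ≥0 => (q.1, c * q.2)) '' Q, hQ.image _, ?_, U, hU, fun y hy => ?_, ?_⟩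
  · rintro _ ⟨q, hq, rfl⟩
    exact hQP q hq
  · obtain ⟨q, hq, hyq⟩ := hUQ y hy
    exact ⟨_, ⟨q, hq, rfl⟩, hyq⟩
  · rintro _ ⟨q, hq, rfl⟩ B hB hBU hBP
    rw [Measure.smul_apply, hd q hq B hB hBU hBP, ENNReal.coe_mul, mul_assoc]
    rfl

/-- Restrictions to sets which are simplices in coordinates, and to their complements. -/
theorem HasPLDensityAt.restrict {κ : Type*} [Fintype κ] (h : HasPLDensityAt ι μ x)
    (S : CoordSimplex κ E) {V : Set X} (hVm : MeasurableSet V)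
    (hV : ∀ᶠ y in 𝓝 x, y ∈ V ↔ ι y ∈ S.carrier) :
    HasPLDensityAt ι (μ.restrict V) x ∧ HasPLDensityAt ι (μ.restrict Vᶜ) x := by
  obtain ⟨Q, hQ, hQP, U, hU, hUQ, hd⟩ := h
  obtain ⟨W, hW, hWV⟩ := hV.exists_mem
  -- The complement of the simplex is covered by the half-spaces `coord i ≤ 0`, each meeting the
  -- simplex only in a null hyperplane. Densities become `a` inside and `b` outside: identity and
  -- zero for `V`, zero and identity for its complement.
  have main : ∀ a b : ℝ≥0 → ℝ≥0, ∀ ν : Measure X,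
      (∀ q ∈ Q, ∀ B, MeasurableSet B → B ⊆ U ∩ W → (∀ y ∈ B, ι y ∈ q.1) → B ⊆ V →
        ν B = a q.2 * volume (ι '' B)) →
      (∀ q ∈ Q, ∀ B, MeasurableSet B → B ⊆ U ∩ W → (∀ y ∈ B, ι y ∈ q.1) → μ (B ∩ V) = 0 →
        ν B = b q.2 * volume (ι '' B)) → HasPLDensityAt ι ν x := by
    intro a b ν ha hb
    refine ⟨(fun q : Set E × ℝ≥0 => (q.1 ∩ S.carrier, a q.2)) '' Q ∪
      (fun p : (Set E × ℝ≥0) × κ => (p.1.1 ∩ {z | 0 ≤ (-S.coord p.2) z}, b p.1.2)) ''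
        (Q ×ˢ univ), (hQ.image _).union ((hQ.prod finite_univ).image _), ?_, U ∩ W,
        inter_mem hU hW, fun y hy => ?_, ?_⟩
    · rintro _ (⟨q, hq, rfl⟩ | ⟨⟨q, i⟩, ⟨hq, -⟩, rfl⟩)
      · exact (hQP q hq).inter S.isConvexPolyhedron_carrier
      · exact (hQP q hq).inter (IsConvexPolyhedron.setOf_nonneg _)
    · obtain ⟨q, hq, hyq⟩ := hUQ y hy.1
      by_cases hS : ι y ∈ S.carrier
      · exact ⟨_, Or.inl ⟨q, hq, rfl⟩, hyq, hS⟩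
      · simp only [CoordSimplex.carrier, mem_ofPred_eq, not_forall, not_le] at hS
        obtain ⟨i, hi⟩ := hS
        exact ⟨_, Or.inr ⟨(q, i), ⟨hq, mem_univ i⟩, rfl⟩, hyq, by simpa using hi.le⟩
    · rintro _ (⟨q, hq, rfl⟩ | ⟨⟨q, i⟩, ⟨hq, -⟩, rfl⟩) B hB hBU hBP
      · exact ha q hq B hB hBU (fun y hy => (hBP y hy).1)
          fun y hy => (hWV y (hBU hy).2).2 (hBP y hy).2
      · refine hb q hq B hB hBU (fun y hy => (hBP y hy).1) ?_
        rw [hd q hq _ (hB.inter hVm) (inter_subset_left.trans (hBU.trans inter_subset_left))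
          fun y hy => (hBP y hy.1).1]
        have h0 : volume (ι '' (B ∩ V)) = 0 := by
          refine measure_mono_null ?_ (S.volume_setOf_coord_eq_zero i)
          rintro _ ⟨y, ⟨hyB, hyV⟩, rfl⟩
          have h1 := (hBP y hyB).2
          have h2 := (hWV y (hBU hyB).2).1 hyV i
          simp only [mem_ofPred_eq, AffineMap.coe_neg, Pi.neg_apply] at h1
          exact le_antisymm (by linarith) h2
        rw [h0, mul_zero]
  constructor
  · refine main id (fun _ => 0) _ (fun q hq B hB hBU hBP hBV => ?_) fun q hq B hB hBU hBP h0 => ?_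
    · rw [Measure.restrict_apply hB, inter_eq_left.2 hBV]
      exact hd q hq B hB (hBU.trans inter_subset_left) hBP
    · rw [Measure.restrict_apply hB, h0]
      simp
  · refine main (fun _ => 0) id _ (fun q hq B hB hBU hBP hBV => ?_) fun q hq B hB hBU hBP h0 => ?_
    · rw [Measure.restrict_apply hB, (disjoint_compl_right_iff_subset.2 hBV).inter_eq]
      simp
    · rw [Measure.restrict_apply hB, ← Set.sdiff_eq, measure_sdiff_null' h0]
      exact hd q hq B hB (hBU.trans inter_subset_left) hBP

end Density

/-! ### Small simplices in the half-space -/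

namespace PLHalfSpace

variable {n : ℕ}

/-- The half-space as a subset of `ℝⁿ`. -/
def image (n : ℕ) : Set (EuclideanSpace ℝ (Fin n)) := {x | ∀ i : Fin n, i.val = 0 → 0 ≤ x i}

theorem incl_mem (x : PLHalfSpace n) : x.incl ∈ image n := x.2

theorem incl_injective : Function.Injective (incl : PLHalfSpace n → _) := Subtype.val_injective

/-- The retraction of `ℝⁿ` onto the half-space. -/
noncomputable def retract (x : EuclideanSpace ℝ (Fin n)) : PLHalfSpace n :=
  ⟨WithLp.toLp 2 fun i => if i.val = 0 then max (x i) 0 else x i, fun i hi => by simp [hi]⟩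

theorem incl_retract {x : EuclideanSpace ℝ (Fin n)} (hx : x ∈ image n) : (retract x).incl = x := by
  ext i
  by_cases h : i.val = 0
  · simp [retract, incl, h, max_eq_left (hx i h)]
  · simp [retract, incl, h]

theorem retract_incl (x : PLHalfSpace n) : retract x.incl = x :=
  incl_injective (incl_retract x.incl_mem)

theorem continuous_retract : Continuous (retract : _ → PLHalfSpace n) := by
  refine Continuous.subtype_mk ?_ _
  refine (PiLp.continuous_toLp 2 _).comp (continuous_pi fun i => ?_)
  by_cases h : i.val = 0
  · simp only [h, if_true]; fun_prop
  · simp only [h, if_false]; fun_prop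

theorem continuous_incl : Continuous (incl : PLHalfSpace n → _) := (isInducing_incl n).continuous

end PLHalfSpace

/-- The simplex `{x | l ≤ x, ∑ (x i - l i) ≤ r}`. -/
noncomputable def cornerSimplex {n : ℕ} (l : EuclideanSpace ℝ (Fin n)) {r : ℝ} (hr : r ≠ 0) :
    CoordSimplex (Option (Fin n)) (EuclideanSpace ℝ (Fin n)) where
  pt i := i.elim l fun i => l + r • EuclideanSpace.single i 1
  coord i := i.elim (AffineMap.const ℝ _ 1 -
      r⁻¹ • ((∑ i, EuclideanSpace.proj i : _ →L[ℝ] ℝ).toLinearMap.toAffineMap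
        - AffineMap.const ℝ _ (∑ i, l i)))
    fun i => r⁻¹ • ((EuclideanSpace.proj i : _ →L[ℝ] ℝ).toLinearMap.toAffineMap
      - AffineMap.const ℝ _ (l i))
  coord_self i := by
    cases i with
    | none => simp
    | some i => simp [hr]
  coord_ne i j hij := by
    cases i with
    | none => cases j with
      | none => exact absurd rfl hij
      | some j => simp [hr, Finset.sum_add_distrib]
    | some i => cases j with
      | none => simp
      | some j =>
        have : i ≠ j := fun h => hij (h ▸ rfl)
        simp [this]
  sum_coord x := by
    rw [Fintype.sum_option]
    simp [← Finset.mul_sum, Finset.sum_sub_distrib]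
  sum_smul x := by
    rw [Fintype.sum_option]
    ext j
    have e : ∑ i, r⁻¹ * (x i - l i) * l j = r⁻¹ * (∑ i, x i - ∑ i, l i) * l j := by
      rw [← Finset.sum_mul, ← Finset.mul_sum, Finset.sum_sub_distrib]
    simp [Finset.sum_add_distrib, e, -Finset.sum_sub_distrib, Pi.single_apply]
    field_simp
    ring

theorem mem_carrier_cornerSimplex {n : ℕ} {l : EuclideanSpace ℝ (Fin n)} {r : ℝ} (hr : 0 < r)
    {x : EuclideanSpace ℝ (Fin n)} :
    x ∈ (cornerSimplex l hr.ne').carrier ↔ (∀ i, l i ≤ x i) ∧ ∑ i, x i - ∑ i, l i ≤ r := by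
  simp only [CoordSimplex.carrier, mem_ofPred_eq, Option.forall]
  rw [and_comm]
  refine and_congr (forall_congr' fun i => ?_) ?_
  · simp [cornerSimplex, hr]
  · simp [cornerSimplex, inv_mul_le_iff₀ hr]

/-- The simplices are a basis of neighbourhoods in the half-space. -/
theorem exists_simplex_subset {n : ℕ} {x : EuclideanSpace ℝ (Fin n)}
    (hx : x ∈ PLHalfSpace.image n) {V : Set (EuclideanSpace ℝ (Fin n))} (hV : V ∈ 𝓝 x) :
    ∃ S : CoordSimplex (Option (Fin n)) (EuclideanSpace ℝ (Fin n)),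
      S.carrier ⊆ V ∩ PLHalfSpace.image n ∧ S.carrier ∈ 𝓝[PLHalfSpace.image n] x := by
  have hV' : WithLp.toLp 2 ⁻¹' V ∈ 𝓝 (WithLp.ofLp x) :=
    (PiLp.continuous_toLp 2 _).continuousAt.preimage_mem_nhds (by simpa using hV)
  obtain ⟨δ, hδ, hball⟩ := Metric.nhds_basis_closedBall.mem_iff.1 hV'
  -- The corner `l` is at most `ε` below `x` in each of `n` coordinates and the size has a slack of
  -- `ε`, so the simplex has size at most `(n + 1) * ε = δ`. Truncating `l` at 0 in the boundary
  -- coordinate keeps the simplex in the half-space without losing nearby points of the half-space.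
  set ε : ℝ := δ / (n + 1) with hε
  have hε0 : 0 < ε := by positivity
  set l : EuclideanSpace ℝ (Fin n) :=
    WithLp.toLp 2 fun i => if i.val = 0 then max (x i - ε) 0 else x i - ε with hl
  have hl1 : ∀ i, x i - ε ≤ l i := fun i => by
    by_cases h : i.val = 0 <;> simp [hl, h]
  have hl2 : ∀ i, l i ≤ x i := fun i => by
    by_cases h : i.val = 0
    · simp [hl, h, hε0.le, hx i h]
    · simp [hl, h, hε0.le]
  have hsum0 : 0 ≤ ∑ i, (x i - l i) := Finset.sum_nonneg fun i _ => sub_nonneg.2 (hl2 i)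
  have hsum1 : ∑ i, (x i - l i) ≤ n * ε := by
    calc ∑ i, (x i - l i) ≤ ∑ _i : Fin n, ε := Finset.sum_le_sum fun i _ => by linarith [hl1 i]
      _ = n * ε := by simp
  have hr : 0 < ∑ i, (x i - l i) + ε := by linarith
  have hrδ : ∑ i, (x i - l i) + ε ≤ δ := by
    have : n * ε + ε = δ := by rw [hε]; field_simp
    linarith
  refine ⟨cornerSimplex l hr.ne', fun y hy => ?_, ?_⟩
  · obtain ⟨h1, h2⟩ := (mem_carrier_cornerSimplex hr).1 hy
    constructor
    · refine hball (a := WithLp.ofLp y) ?_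
      rw [Metric.mem_closedBall, dist_pi_le_iff hδ.le]
      intro i
      have h3 : y i - l i ≤ ∑ i, (y i - l i) :=
        Finset.single_le_sum (f := fun i => y i - l i) (fun i _ => sub_nonneg.2 (h1 i))
          (Finset.mem_univ i)
      rw [Finset.sum_sub_distrib] at h3
      rw [Real.dist_eq, abs_le]
      constructor
      · linarith [h1 i, hl1 i]
      · linarith [hl2 i]
    · intro i hi
      refine le_trans ?_ (h1 i)
      simp [hl, hi]
  · have h1 : ∀ᶠ y in 𝓝 x, ∀ i, x i - ε < y i := by
      rw [eventually_all]
      intro i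
      exact (isOpen_lt continuous_const (by fun_prop)).mem_nhds (by simpa using hε0)
    have h2 : ∀ᶠ y in 𝓝 x, ∑ i, y i - ∑ i, l i < ∑ i, (x i - l i) + ε := by
      refine (isOpen_lt (by fun_prop) continuous_const).mem_nhds ?_
      simp [Finset.sum_sub_distrib, hε0]
    filter_upwards [mem_nhdsWithin_of_mem_nhds h1, mem_nhdsWithin_of_mem_nhds h2,
      self_mem_nhdsWithin] with y h1 h2 hy
    refine (mem_carrier_cornerSimplex hr).2 ⟨fun i => ?_, h2.le⟩
    by_cases h : i.val = 0
    · simp only [hl, h, if_true]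
      exact max_le (h1 i).le (hy i h)
    · simp only [hl, h, if_false]
      exact (h1 i).le

theorem ContinuousOn.measurableSet_inter_preimage {X Y : Type*} [TopologicalSpace X]
    [MeasurableSpace X] [BorelSpace X] [TopologicalSpace Y] [MeasurableSpace Y] [BorelSpace Y]
    {f : X → Y} {s : Set X} (hf : ContinuousOn f s) (hs : MeasurableSet s) {t : Set Y}
    (ht : MeasurableSet t) : MeasurableSet (s ∩ f ⁻¹' t) := by
  have h := (continuousOn_iff_continuous_domRestrict.1 hf).measurable ht
  have e : s ∩ f ⁻¹' t = Subtype.val '' (s.domRestrict f ⁻¹' t) := by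
    ext x; simp [Set.domRestrict, and_comm]
  rw [e]
  exact hs.subtype_image h

/-! ### Simplices in charts -/

section Manifold

variable {n : ℕ} {M : Type*} [TopologicalSpace M]

/-- The coordinates in `ℝⁿ` given by a chart. -/
noncomputable def chartCoord (e : OpenPartialHomeomorph M (PLHalfSpace n)) (q : M) :
    EuclideanSpace ℝ (Fin n) := (e q).incl

/-- The inverse of `chartCoord`. -/
noncomputable def chartPoint (e : OpenPartialHomeomorph M (PLHalfSpace n))
    (x : EuclideanSpace ℝ (Fin n)) : M := e.symm (PLHalfSpace.retract x)

theorem chartPoint_chartCoord {e : OpenPartialHomeomorph M (PLHalfSpace n)} {q : M}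
    (hq : q ∈ e.source) : chartPoint e (chartCoord e q) = q := by
  rw [chartPoint, chartCoord, PLHalfSpace.retract_incl, e.left_inv hq]

theorem continuousOn_chartCoord (e : OpenPartialHomeomorph M (PLHalfSpace n)) :
    ContinuousOn (chartCoord e) e.source :=
  PLHalfSpace.continuous_incl.comp_continuousOn e.continuousOn

theorem injOn_chartCoord (e : OpenPartialHomeomorph M (PLHalfSpace n)) :
    InjOn (chartCoord e) e.source :=
  fun _ hp _ hq h => by rw [← chartPoint_chartCoord hp, h, chartPoint_chartCoord hq]

/-- A simplex in the image of a chart. -/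
structure ChartSimplex (n : ℕ) (M : Type*) [TopologicalSpace M] where
  /-- the chart -/
  e : OpenPartialHomeomorph M (PLHalfSpace n)
  /-- the simplex -/
  S : CoordSimplex (Option (Fin n)) (EuclideanSpace ℝ (Fin n))
  carrier_subset : S.carrier ⊆ PLHalfSpace.incl '' e.target

namespace ChartSimplex

variable (D : ChartSimplex n M)

/-- The simplex as a subset of the manifold. -/
def carrier : Set M := {q | q ∈ D.e.source ∧ chartCoord D.e q ∈ D.S.carrier}

theorem chartPoint_mem_source {x : EuclideanSpace ℝ (Fin n)} (hx : x ∈ D.S.carrier) :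
    chartPoint D.e x ∈ D.e.source := by
  obtain ⟨y, hy, rfl⟩ := D.carrier_subset hx
  rw [chartPoint, PLHalfSpace.retract_incl]
  exact D.e.map_target hy

theorem chartCoord_chartPoint {x : EuclideanSpace ℝ (Fin n)} (hx : x ∈ D.S.carrier) :
    chartCoord D.e (chartPoint D.e x) = x := by
  obtain ⟨y, hy, rfl⟩ := D.carrier_subset hx
  rw [chartPoint, PLHalfSpace.retract_incl, chartCoord, D.e.right_inv hy]

theorem chartPoint_mem {x : EuclideanSpace ℝ (Fin n)} (hx : x ∈ D.S.carrier) :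
    chartPoint D.e x ∈ D.carrier :=
  ⟨D.chartPoint_mem_source hx, by rwa [D.chartCoord_chartPoint hx]⟩

theorem continuousOn_chartPoint : ContinuousOn (chartPoint D.e) D.S.carrier := by
  refine D.e.continuousOn_symm.comp PLHalfSpace.continuous_retract.continuousOn fun x hx => ?_
  obtain ⟨y, hy, rfl⟩ := D.carrier_subset hx
  rwa [PLHalfSpace.retract_incl]

theorem carrier_eq_image : D.carrier = chartPoint D.e '' D.S.carrier :=
  Set.Subset.antisymm (fun _ hq => ⟨_, hq.2, chartPoint_chartCoord hq.1⟩)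
    (by rintro _ ⟨x, hx, rfl⟩; exact D.chartPoint_mem hx)

theorem isClosed_carrier [T2Space M] : IsClosed D.carrier := by
  rw [carrier_eq_image]
  exact (D.S.isCompact_carrier.image_of_continuousOn D.continuousOn_chartPoint).isClosed

theorem carrier_subset_source : D.carrier ⊆ D.e.source := fun _ hq => hq.1

variable [T2Space M] [MeasurableSpace M] [BorelSpace M]

theorem measurableSet_carrier : MeasurableSet D.carrier := D.isClosed_carrier.measurableSet

theorem measurableSet_inter_preimage {C : Set (EuclideanSpace ℝ (Fin n))} (hC : MeasurableSet C) :
    MeasurableSet (D.carrier ∩ chartCoord D.e ⁻¹' C) :=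
  ((continuousOn_chartCoord D.e).mono D.carrier_subset_source).measurableSet_inter_preimage
    D.measurableSet_carrier hC

/-- The measure on the simplex, in the coordinates given by the chart. -/
noncomputable def pushed (μ : Measure M) : Measure (EuclideanSpace ℝ (Fin n)) :=
  Measure.map (chartCoord D.e) (μ.restrict D.carrier)

theorem pushed_apply (μ : Measure M) {C : Set (EuclideanSpace ℝ (Fin n))} (hC : MeasurableSet C) :
    D.pushed μ C = μ (D.carrier ∩ chartCoord D.e ⁻¹' C) := by
  rw [pushed, Measure.map_apply_of_aemeasurable
    (((continuousOn_chartCoord D.e).mono D.carrier_subset_source).aemeasurable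
      D.measurableSet_carrier) hC, Measure.restrict_apply' D.measurableSet_carrier, inter_comm]

theorem pushed_apply_image (μ : Measure M) {B : Set M} (hB : MeasurableSet B)
    (hBD : B ⊆ D.carrier) :
    MeasurableSet (chartCoord D.e '' B) ∧ D.pushed μ (chartCoord D.e '' B) = μ B := by
  have e : chartCoord D.e '' B = D.S.carrier ∩ chartPoint D.e ⁻¹' B := by
    ext x
    constructor
    · rintro ⟨q, hq, rfl⟩
      exact ⟨(hBD hq).2, by rwa [mem_preimage, chartPoint_chartCoord (hBD hq).1]⟩
    · rintro ⟨hx, hxB⟩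
      exact ⟨_, hxB, D.chartCoord_chartPoint hx⟩
  have hm : MeasurableSet (chartCoord D.e '' B) := by
    rw [e]
    exact D.continuousOn_chartPoint.measurableSet_inter_preimage D.S.measurableSet_carrier hB
  refine ⟨hm, ?_⟩
  rw [D.pushed_apply μ hm]
  congr 1
  ext q
  constructor
  · rintro ⟨hq, q', hq', h⟩
    rwa [← injOn_chartCoord D.e (hBD hq').1 hq.1 h]
  · exact fun hq => ⟨hBD hq, mem_image_of_mem _ hq⟩

/-- A measure with positive piecewise constant density can be flattened on a simplex. -/
theorem flattens (μ : Measure M) [μ.IsOpenPosMeasure]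
    (hμ : ∀ q ∈ D.carrier, HasPLDensityAt (chartCoord D.e) μ q) :
    Flattens (D.pushed μ) D.S.carrier := by
  obtain ⟨Q, hQ, hQP, hcov, hd⟩ : ∃ Q : Set (Set (EuclideanSpace ℝ (Fin n)) × ℝ≥0), Q.Finite ∧
      (∀ q ∈ Q, IsConvexPolyhedron q.1) ∧ (∀ x ∈ D.S.carrier, ∃ q ∈ Q, x ∈ q.1) ∧
      ∀ q ∈ Q, ∀ C, MeasurableSet C → C ⊆ D.S.carrier → C ⊆ q.1 →
        D.pushed μ C = q.2 * volume C := by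
    -- Compactness makes the local families of polyhedra into one finite family. Only the covering
    -- condition refers to `A`; the density condition must hold on the whole simplex, which is
    -- arranged by intersecting the local polyhedra with a small simplex `T` inside the region where
    -- the local formula is valid.
    refine D.S.isCompact_carrier.induction_on
      (p := fun A => ∃ Q : Set (Set (EuclideanSpace ℝ (Fin n)) × ℝ≥0), Q.Finite ∧
      (∀ q ∈ Q, IsConvexPolyhedron q.1) ∧ (∀ x ∈ A, ∃ q ∈ Q, x ∈ q.1) ∧
      ∀ q ∈ Q, ∀ C, MeasurableSet C → C ⊆ D.S.carrier → C ⊆ q.1 →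
        D.pushed μ C = q.2 * volume C) ⟨∅, finite_empty, by simp, by simp, by simp⟩ ?_ ?_ ?_
    · rintro s t hst ⟨Q, hQ, hQP, hcov, hd⟩
      exact ⟨Q, hQ, hQP, fun x hx => hcov x (hst hx), hd⟩
    · rintro s t ⟨Q, hQ, hQP, hcov, hd⟩ ⟨Q', hQ', hQP', hcov', hd'⟩
      refine ⟨Q ∪ Q', hQ.union hQ', fun q hq => hq.elim (hQP q) (hQP' q), fun x hx => ?_,
        fun q hq => hq.elim (hd q) (hd' q)⟩
      rcases hx with hx | hx
      · obtain ⟨q, hq, h⟩ := hcov x hx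
        exact ⟨q, Or.inl hq, h⟩
      · obtain ⟨q, hq, h⟩ := hcov' x hx
        exact ⟨q, Or.inr hq, h⟩
    · intro x hx
      obtain ⟨Q, hQ, hQP, U, hU, hUQ, hd⟩ := hμ _ (D.chartPoint_mem hx)
      have h1 := D.continuousOn_chartPoint x hx hU
      obtain ⟨V, hV, hVU⟩ := mem_nhdsWithin_iff_exists_mem_nhds_inter.1 (mem_map.1 h1)
      have himg : D.S.carrier ⊆ PLHalfSpace.image n := fun y hy => by
        obtain ⟨z, -, rfl⟩ := D.carrier_subset hy
        exact z.incl_mem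
      obtain ⟨T, hTV, hT⟩ := exists_simplex_subset (himg hx) hV
      have hTU : ∀ y ∈ T.carrier, y ∈ D.S.carrier → chartPoint D.e y ∈ U := fun y hy hyS =>
        hVU ⟨(hTV hy).1, hyS⟩
      refine ⟨T.carrier ∩ D.S.carrier, inter_mem (nhdsWithin_mono x himg hT) self_mem_nhdsWithin,
        (fun q : Set (EuclideanSpace ℝ (Fin n)) × ℝ≥0 => (T.carrier ∩ q.1, q.2)) '' Q,
        hQ.image _, ?_, fun y hy => ?_, ?_⟩
      · rintro _ ⟨q, hq, rfl⟩
        exact T.isConvexPolyhedron_carrier.inter (hQP q hq)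
      · obtain ⟨q, hq, hyq⟩ := hUQ _ (hTU y hy.1 hy.2)
        rw [D.chartCoord_chartPoint hy.2] at hyq
        exact ⟨_, ⟨q, hq, rfl⟩, hy.1, hyq⟩
      · rintro _ ⟨q, hq, rfl⟩ C hC hCS hCq
        rw [D.pushed_apply μ hC, hd q hq _ (D.measurableSet_inter_preimage hC)]
        · congr 2
          refine Set.Subset.antisymm ?_ fun y hy => ?_
          · rintro _ ⟨q, hq, rfl⟩
            exact hq.2
          · exact ⟨chartPoint D.e y, ⟨D.chartPoint_mem (hCS hy), by
              rwa [mem_preimage, D.chartCoord_chartPoint (hCS hy)]⟩, D.chartCoord_chartPoint (hCS hy)⟩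
        · rintro p ⟨hp, hpC⟩
          rw [← chartPoint_chartCoord hp.1]
          exact hTU _ (hCq hpC).1 hp.2
        · rintro p ⟨hp, hpC⟩
          exact (hCq hpC).2
  refine D.S.flattens_of_polyhedral hQ hQP hcov hd fun U hU hUne hUS => ?_
  rw [D.pushed_apply μ hU.measurableSet]
  -- Rewritten with the chart domain, the set is visibly open in `M`, so it has positive measure.
  have e : D.carrier ∩ chartCoord D.e ⁻¹' U = D.e.source ∩ chartCoord D.e ⁻¹' U :=
    Set.Subset.antisymm (inter_subset_inter_left _ D.carrier_subset_source)
      fun q hq => ⟨⟨hq.1, hUS hq.2⟩, hq.2⟩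
  rw [e]
  obtain ⟨x, hx⟩ := hUne
  exact ((continuousOn_chartCoord D.e).isOpen_inter_preimage D.e.open_source hU).measure_ne_zero μ
    ⟨chartPoint D.e x, D.chartPoint_mem_source (hUS hx), by
      rwa [mem_preimage, D.chartCoord_chartPoint (hUS hx)]⟩

end ChartSimplex

end Manifold

/-! ### Extending homeomorphisms from a chart simplex to the manifold -/

section Charts

variable {n : ℕ} {M : Type*} [TopologicalSpace M] [ChartedSpace (PLHalfSpace n) M]

theorem plAt_of_mem_plGroupoid {h : OpenPartialHomeomorph (PLHalfSpace n) (PLHalfSpace n)}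
    (hh : h ∈ plGroupoid n) {x : PLHalfSpace n} (hx : x ∈ h.source) :
    PLAt PLHalfSpace.incl (fun y => (h y).incl) x :=
  (mem_groupoid_of_pregroupoid.1 hh).1 x hx

theorem plAt_chartCoord [HasGroupoid M (plGroupoid n)]
    {e e' : OpenPartialHomeomorph M (PLHalfSpace n)} (he : e ∈ atlas (PLHalfSpace n) M)
    (he' : e' ∈ atlas (PLHalfSpace n) M) {p : M} (hp : p ∈ e.source) (hp' : p ∈ e'.source) :
    PLAt (chartCoord e) (chartCoord e') p := by
  have h1 := plAt_of_mem_plGroupoid (HasGroupoid.compatible (G := plGroupoid n) he he')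
    (x := e p) (by simp [hp, hp'])
  have h2 := PLAt.comp (ι := chartCoord e) (f := e) h1 (PLAt.self _ p) (e.continuousAt hp)
  refine h2.congr ?_
  filter_upwards [e.open_source.mem_nhds hp] with q hq
  simp [chartCoord, e.left_inv hq]

theorem IsPLHomeomorph.trans {f g : M ≃ₜ M} (hf : IsPLHomeomorph n f) (hg : IsPLHomeomorph n g) :
    IsPLHomeomorph n (f.trans g) :=
  ⟨fun p => (hg.1 (f p)).comp (hf.1 p) f.continuous.continuousAt,
    fun p => (hf.2 (g.symm p)).comp (hg.2 p) g.symm.continuous.continuousAt⟩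

theorem IsPLHomeomorph.symm {f : M ≃ₜ M} (hf : IsPLHomeomorph n f) : IsPLHomeomorph n f.symm :=
  ⟨hf.2, hf.1⟩

namespace ChartSimplex

variable (D : ChartSimplex n M)

/-- Since `g` preserves the simplex and fixes everything else, it preserves the chart image,
including its part on the boundary of the half-space. -/
theorem mem_image_target {g : EuclideanSpace ℝ (Fin n) ≃ₜ EuclideanSpace ℝ (Fin n)}
    (hg : ∀ x ∉ D.S.carrier, g x = x) {x : EuclideanSpace ℝ (Fin n)}
    (hx : x ∈ PLHalfSpace.incl '' D.e.target) : g x ∈ PLHalfSpace.incl '' D.e.target := by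
  by_cases h : x ∈ D.S.carrier
  · have := mem_image_of_mem g h
    rw [Homeomorph.image_eq_of_eq_off hg] at this
    exact D.carrier_subset this
  · rwa [hg x h]

open Classical in
/-- The extension to the manifold of a map which is the identity outside a simplex. -/
noncomputable def extend (g : EuclideanSpace ℝ (Fin n) → EuclideanSpace ℝ (Fin n)) (q : M) : M :=
  if q ∈ D.e.source then chartPoint D.e (g (chartCoord D.e q)) else q

theorem extend_of_mem (g : EuclideanSpace ℝ (Fin n) → EuclideanSpace ℝ (Fin n)) {q : M}
    (hq : q ∈ D.e.source) : D.extend g q = chartPoint D.e (g (chartCoord D.e q)) :=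
  if_pos hq

variable {g : EuclideanSpace ℝ (Fin n) ≃ₜ EuclideanSpace ℝ (Fin n)}

theorem extend_mem_source (hg : ∀ x ∉ D.S.carrier, g x = x) {q : M} (hq : q ∈ D.e.source) :
    D.extend g q ∈ D.e.source ∧ chartCoord D.e (D.extend g q) = g (chartCoord D.e q) := by
  rw [D.extend_of_mem _ hq]
  obtain ⟨y, hy, h⟩ := D.mem_image_target hg (mem_image_of_mem _ (D.e.map_source hq))
  change y.incl = g (chartCoord D.e q) at h
  rw [← h, chartPoint, PLHalfSpace.retract_incl, chartCoord, D.e.right_inv hy]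
  exact ⟨D.e.map_target hy, rfl⟩

theorem extend_of_notMem (hg : ∀ x ∉ D.S.carrier, g x = x) {q : M} (hq : q ∉ D.carrier) :
    D.extend g q = q := by
  by_cases h : q ∈ D.e.source
  · rw [D.extend_of_mem _ h, hg _ fun hS => hq ⟨h, hS⟩, chartPoint_chartCoord h]
  · exact if_neg h

theorem extend_symm_extend (hg : ∀ x ∉ D.S.carrier, g x = x) (q : M) :
    D.extend g.symm (D.extend g q) = q := by
  by_cases h : q ∈ D.e.source
  · obtain ⟨h1, h2⟩ := D.extend_mem_source hg h
    rw [D.extend_of_mem _ h1, h2, g.symm_apply_apply, chartPoint_chartCoord h]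
  · have : D.extend g q = q := if_neg h
    rw [this]
    exact if_neg h

theorem extend_mem_carrier (hg : ∀ x ∉ D.S.carrier, g x = x) {q : M} (hq : q ∈ D.carrier) :
    D.extend g q ∈ D.carrier := by
  obtain ⟨h1, h2⟩ := D.extend_mem_source hg hq.1
  refine ⟨h1, ?_⟩
  rw [h2, ← Homeomorph.image_eq_of_eq_off hg]
  exact mem_image_of_mem _ hq.2

variable [T2Space M]

/-- The chart domain and the complement of the simplex form an open cover, the simplex being compact
in a Hausdorff space. On the first the map is `g` in coordinates, on the second the identity. The PL
property is checked in the same way. -/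
theorem continuous_extend (hg : ∀ x ∉ D.S.carrier, g x = x) : Continuous (D.extend g) := by
  rw [continuous_iff_continuousAt]
  intro p
  by_cases hp : p ∈ D.e.source
  · have h1 : ContinuousAt (chartCoord D.e) p :=
      (continuousOn_chartCoord D.e).continuousAt (D.e.open_source.mem_nhds hp)
    have h2 : ContinuousAt (fun q => D.e.symm (PLHalfSpace.retract (g (chartCoord D.e q)))) p := by
      have h3 : ContinuousAt (fun q => PLHalfSpace.retract (g (chartCoord D.e q))) p :=
        (PLHalfSpace.continuous_retract.comp g.continuous).continuousAt.comp h1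
      refine ContinuousAt.comp (g := D.e.symm) (D.e.continuousAt_symm ?_) h3
      obtain ⟨y, hy, h⟩ := D.mem_image_target hg (mem_image_of_mem _ (D.e.map_source hp))
      change y.incl = g (chartCoord D.e p) at h
      rwa [← h, PLHalfSpace.retract_incl]
    refine h2.congr ?_
    filter_upwards [D.e.open_source.mem_nhds hp] with q hq
    rw [D.extend_of_mem _ hq]
    rfl
  · have hp' : p ∉ D.carrier := fun h => hp h.1
    refine continuousAt_id.congr ?_
    filter_upwards [D.isClosed_carrier.isOpen_compl.mem_nhds hp'] with q hq
    rw [D.extend_of_notMem hg hq]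
    rfl

theorem plAt_extend [HasGroupoid M (plGroupoid n)] (hD : D.e ∈ atlas (PLHalfSpace n) M)
    (hg : ∀ x ∉ D.S.carrier, g x = x) (hpl : ∀ x, PLAt (id : _ → EuclideanSpace ℝ (Fin n)) g x)
    (p : M) :
    PLAt (plCoord n p) (fun q => plCoord n (D.extend g p) (D.extend g q)) p := by
  have hc := (D.continuous_extend hg).continuousAt (x := p)
  by_cases hp : p ∈ D.e.source
  · obtain ⟨h1, h2⟩ := D.extend_mem_source hg hp
    have hch := plAt_chartCoord (chart_mem_atlas (PLHalfSpace n) p) hD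
      (mem_chart_source (PLHalfSpace n) p) hp
    have h3 : PLAt (plCoord n p) (fun q => g (chartCoord D.e q)) p :=
      (hpl (chartCoord D.e p)).comp_id hch
        ((continuousOn_chartCoord D.e).continuousAt (D.e.open_source.mem_nhds hp))
    have h4 : PLAt (plCoord n p) (fun q => chartCoord D.e (D.extend g q)) p := by
      refine h3.congr ?_
      filter_upwards [D.e.open_source.mem_nhds hp] with q hq
      exact (D.extend_mem_source hg hq).2
    exact PLAt.comp (plAt_chartCoord hD (chart_mem_atlas (PLHalfSpace n) _) h1
      (mem_chart_source (PLHalfSpace n) _)) h4 hc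
  · have hp' : p ∉ D.carrier := fun h => hp h.1
    refine (PLAt.self (plCoord n p) p).congr ?_
    filter_upwards [D.isClosed_carrier.isOpen_compl.mem_nhds hp'] with q hq
    rw [D.extend_of_notMem hg hq, D.extend_of_notMem hg hp']

theorem exists_extend [HasGroupoid M (plGroupoid n)] (hD : D.e ∈ atlas (PLHalfSpace n) M)
    (hg : ∀ x ∉ D.S.carrier, g x = x) (hpl : IsPLEquiv g) :
    ∃ f : M ≃ₜ M, IsPLHomeomorph n f ∧ ∀ q, f q = D.extend g q :=
  have hg' := Homeomorph.symm_eq_off hg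
  ⟨{ toFun := D.extend g
     invFun := D.extend g.symm
     left_inv := D.extend_symm_extend hg
     right_inv := fun q => by
       have := D.extend_symm_extend hg' q
       rwa [g.symm_symm] at this
     continuous_toFun := D.continuous_extend hg
     continuous_invFun := D.continuous_extend hg' },
    ⟨D.plAt_extend hD hg hpl.1, D.plAt_extend hD hg' hpl.2⟩, fun _ => rfl⟩

variable [MeasurableSpace M] [BorelSpace M]

theorem measure_preimage_extend {μ : Measure M} {c : ℝ} (hg : ∀ x ∉ D.S.carrier, g x = x)
    (hmap : Measure.map g ((D.pushed μ).restrict D.S.carrier) =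
      ENNReal.ofReal c • volume.restrict D.S.carrier) {B : Set M} (hB : MeasurableSet B)
    (hBD : B ⊆ D.carrier) :
    μ (D.extend g ⁻¹' B) = ENNReal.ofReal c * volume (chartCoord D.e '' B) := by
  have hm := (D.pushed_apply_image μ hB hBD).1
  have hsub : chartCoord D.e '' B ⊆ D.S.carrier := by
    rintro _ ⟨q, hq, rfl⟩
    exact (hBD hq).2
  have hgm : MeasurableSet (g ⁻¹' (chartCoord D.e '' B)) := g.continuous.measurable hm
  have h := congrArg (fun ν => ν (chartCoord D.e '' B)) hmap
  simp only [Measure.smul_apply, smul_eq_mul] at h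
  rw [Measure.map_apply g.continuous.measurable hm, Measure.restrict_apply hgm,
    Measure.restrict_apply hm, inter_eq_left.2 hsub,
    D.pushed_apply μ (hgm.inter D.S.measurableSet_carrier)] at h
  rw [← h]
  congr 1
  ext q
  constructor
  · intro hq
    have hqD : q ∈ D.carrier := by
      by_contra hn
      have h1 := D.extend_of_notMem hg hn
      rw [mem_preimage, h1] at hq
      exact hn (hBD hq)
    refine ⟨hqD, ?_, hqD.2⟩
    rw [mem_preimage, ← (D.extend_mem_source hg hqD.1).2]
    exact mem_image_of_mem _ hq
  · rintro ⟨hqD, hq, -⟩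
    obtain ⟨q', hq', h'⟩ := hq
    rw [← (D.extend_mem_source hg hqD.1).2] at h'
    rw [mem_preimage, ← injOn_chartCoord D.e (hBD hq').1 (D.extend_mem_source hg hqD.1).1 h']
    exact hq'

theorem volume_carrier_pos : 0 < volume D.S.carrier := by
  obtain ⟨x, hx⟩ := D.S.exists_forall_coord_pos
  refine lt_of_lt_of_le (D.S.isOpen_setOf_coord_pos.measure_pos volume ⟨x, hx⟩)
    (measure_mono fun y hy i => (hy i).le)

/-- Measures with positive piecewise constant densities that agree outside a simplex and give it
the same mass are related by a PL homeomorphism. -/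
theorem exists_isPLHomeomorph [HasGroupoid M (plGroupoid n)] (hD : D.e ∈ atlas (PLHalfSpace n) M)
    {μ ν : Measure M} [μ.IsOpenPosMeasure] [ν.IsOpenPosMeasure]
    (hμ : ∀ q ∈ D.carrier, HasPLDensityAt (chartCoord D.e) μ q)
    (hν : ∀ q ∈ D.carrier, HasPLDensityAt (chartCoord D.e) ν q)
    (hoff : μ.restrict D.carrierᶜ = ν.restrict D.carrierᶜ) (hmass : μ D.carrier = ν D.carrier) :
    ∃ f : M ≃ₜ M, IsPLHomeomorph n f ∧ Measure.map f μ = ν := by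
  obtain ⟨c₁, g₁, hc₁, hg₁, hoff₁, hmap₁⟩ := D.flattens μ hμ
  obtain ⟨c₂, g₂, hc₂, hg₂, hoff₂, hmap₂⟩ := D.flattens ν hν
  obtain ⟨f₁, hf₁, hfe₁⟩ := D.exists_extend hD hoff₁ hg₁
  obtain ⟨f₂, hf₂, hfe₂⟩ := D.exists_extend hD hoff₂ hg₂
  have hpre : ∀ {g : EuclideanSpace ℝ (Fin n) ≃ₜ EuclideanSpace ℝ (Fin n)}
      (_ : ∀ x ∉ D.S.carrier, g x = x), D.extend g ⁻¹' D.carrier = D.carrier := by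
    intro g hg
    ext q
    refine ⟨fun hq => ?_, D.extend_mem_carrier hg⟩
    by_contra hn
    rw [mem_preimage, D.extend_of_notMem hg hn] at hq
    exact hn hq
  have himg : chartCoord D.e '' D.carrier = D.S.carrier := by
    rw [D.carrier_eq_image, image_image]
    exact (image_congr fun x hx => D.chartCoord_chartPoint hx).trans (image_id _)
  -- Both constants are the common mass divided by the volume of the simplex. Hence `f₁` and `f₂`
  -- send the two measures to the same one, and `f₁` followed by the inverse of `f₂` works.
  have hcc : ENNReal.ofReal c₁ = ENNReal.ofReal c₂ := by
    have h1 := D.measure_preimage_extend hoff₁ hmap₁ D.measurableSet_carrier subset_rfl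
    have h2 := D.measure_preimage_extend hoff₂ hmap₂ D.measurableSet_carrier subset_rfl
    rw [hpre hoff₁, himg] at h1
    rw [hpre hoff₂, himg, ← hmass, h1] at h2
    exact (ENNReal.mul_left_inj D.volume_carrier_pos.ne'
      D.S.isCompact_carrier.measure_lt_top.ne).1 h2
  have key : Measure.map f₁ μ = Measure.map f₂ ν := by
    have aux : ∀ {f : M ≃ₜ M} {g : EuclideanSpace ℝ (Fin n) ≃ₜ EuclideanSpace ℝ (Fin n)}
        {ρ : Measure M} (_ : ∀ q, f q = D.extend g q) (_ : ∀ x ∉ D.S.carrier, g x = x) {c : ℝ}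
        (_ : Measure.map g ((D.pushed ρ).restrict D.S.carrier) =
          ENNReal.ofReal c • volume.restrict D.S.carrier) {B : Set M} (_ : MeasurableSet B),
        Measure.map f ρ B = ENNReal.ofReal c * volume (chartCoord D.e '' (B ∩ D.carrier)) +
          ρ.restrict D.carrierᶜ B := by
      intro f g ρ hf hg c hc B hB
      have hfe : (f : M → M) = D.extend g := funext hf
      rw [Measure.map_apply f.continuous.measurable hB,
        ← measure_inter_add_sdiff _ D.measurableSet_carrier,
        ← D.measure_preimage_extend hg hc (hB.inter D.measurableSet_carrier) inter_subset_right,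
        preimage_inter, hpre hg, ← hfe, Measure.restrict_apply hB]
      congr 2
      ext q
      simp only [Set.mem_sdiff, mem_inter_iff, mem_compl_iff, and_congr_left_iff, mem_preimage]
      intro hq
      rw [hfe, D.extend_of_notMem hg hq]
    ext B hB
    rw [aux hfe₁ hoff₁ hmap₁ hB, aux hfe₂ hoff₂ hmap₂ hB, hcc, hoff]
  refine ⟨f₁.trans f₂.symm, hf₁.trans hf₂.symm, ?_⟩
  have h : Measure.map f₂.symm (Measure.map f₁ μ) = ν := by
    rw [key, Measure.map_map f₂.symm.continuous.measurable f₂.continuous.measurable,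
      Homeomorph.symm_comp_self, Measure.map_id]
  rw [Measure.map_map f₂.symm.continuous.measurable f₁.continuous.measurable] at h
  exact h

end ChartSimplex

end Charts

/-! ### Simplicial measures have positive piecewise constant densities -/

theorem isConvexPolyhedron_convexHull {E : Type*} [NormedAddCommGroup E] [NormedSpace ℝ E]
    [FiniteDimensional ℝ E] {s : Set E} (hs : AffineIndependent ℝ ((↑) : s → E)) :
    IsConvexPolyhedron (convexHull ℝ s) := by
  classical
  obtain ⟨t, hst, hti, htop⟩ := exists_subset_affineIndependent_affineSpan_eq_top hs
  let b : AffineBasis t ℝ E := ⟨((↑) : t → E), hti, by rwa [Subtype.range_coe]⟩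
  have hb : ∀ i : t, b i = i := fun _ => rfl
  have : Fintype t := (finite_set_of_fin_dim_affineIndependent ℝ hti).fintype
  -- The vertices are completed to an affine basis; the simplex is where all coordinates are
  -- nonnegative and those of the added points are also nonpositive.
  refine ⟨range b.coord ∪ (fun i => -b.coord i) '' {i | (i : E) ∉ s},
    (finite_range _).union (Set.toFinite _), ?_⟩
  apply Set.Subset.antisymm
  · refine convexHull_min (fun x hx => ?_) ?_
    · rintro _ (⟨i, rfl⟩ | ⟨i, hi, rfl⟩)
      · have h := b.coord_apply i ⟨x, hst hx⟩
        rw [hb] at h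
        change b.coord i x = _ at h
        rw [h]; positivity
      · have h := b.coord_apply i ⟨x, hst hx⟩
        rw [hb, if_neg (by rintro rfl; exact hi hx)] at h
        change b.coord i x = _ at h
        simp [h]
    · simp only [ofPred_forall]
      refine convex_iInter fun φ => convex_iInter fun _ => ?_
      exact (convex_Ici (0 : ℝ)).affine_preimage φ
  · intro x hx
    have h0 : ∀ i : t, (i : E) ∉ s → b.coord i x = 0 := fun i hi => by
      have h1 := hx _ (Or.inl ⟨i, rfl⟩)
      have h2 := hx _ (Or.inr ⟨i, hi, rfl⟩)
      simp only [AffineMap.coe_neg, Pi.neg_apply] at h2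
      linarith
    have e : ∑ i ∈ Finset.univ.filter (fun i : t => (i : E) ∈ s), b.coord i x • b i = x := by
      rw [Finset.sum_filter_of_ne, b.linear_combination_coord_eq_self]
      intro i _ hi
      by_contra h
      exact hi (by rw [h0 i h, zero_smul])
    have e1 : ∑ i ∈ Finset.univ.filter (fun i : t => (i : E) ∈ s), b.coord i x = 1 := by
      rw [Finset.sum_filter_of_ne, b.sum_coord_apply_eq_one]
      intro i _ hi
      by_contra h
      exact hi (h0 i h)
    rw [← e]
    refine (convex_convexHull ℝ s).sum_mem (fun i _ => hx _ (Or.inl ⟨i, rfl⟩)) e1 fun i hi => ?_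
    exact subset_convexHull ℝ s (Finset.mem_filter.1 hi).2

/-- By Steinhaus, `C - C` is a neighbourhood of 0, so it contains a nonzero multiple of any kernel
vector; two distinct points of `C` would then have the same image. -/
theorem det_ne_zero_of_injOn {E : Type*} [NormedAddCommGroup E] [NormedSpace ℝ E]
    [FiniteDimensional ℝ E] [MeasureSpace E] [BorelSpace E] [(volume : Measure E).IsAddHaarMeasure]
    (A : E →ᵃ[ℝ] E) {C : Set E} (hC : MeasurableSet C) (h0 : volume C ≠ 0) (hA : InjOn A C) :
    LinearMap.det A.linear ≠ 0 := by
  intro hdet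
  obtain ⟨k, hk, hk0⟩ := (Submodule.ne_bot_iff _).1
    (bot_lt_iff_ne_bot.1 (LinearMap.bot_lt_ker_of_det_eq_zero hdet))
  have hnhds := Measure.sub_mem_nhds_zero_of_addHaar_pos volume C hC (pos_iff_ne_zero.2 h0)
  have hlim : Tendsto (fun r : ℝ => r • k) (𝓝[≠] 0) (𝓝 0) := by
    have : Tendsto (fun r : ℝ => r • k) (𝓝 0) (𝓝 ((0 : ℝ) • k)) :=
      (continuous_id.smul continuous_const).tendsto 0
    rw [zero_smul] at this
    exact this.mono_left nhdsWithin_le_nhds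
  obtain ⟨r, hr, hr0⟩ := ((hlim.eventually hnhds).and self_mem_nhdsWithin).exists
  obtain ⟨x, hx, y, hy, hxy⟩ := hr
  change x - y = r • k at hxy
  have h1 := A.linearMap_vsub x y
  simp only [vsub_eq_sub] at h1
  rw [hxy, map_smul, LinearMap.mem_ker.1 hk, smul_zero] at h1
  have h2 := hA hx hy (sub_eq_zero.1 h1.symm)
  rw [h2, sub_self] at hxy
  exact (smul_ne_zero hr0 hk0) hxy.symm

section Simplicial

variable {n : ℕ} {M : Type*} [TopologicalSpace M] [ChartedSpace (PLHalfSpace n) M]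

theorem exists_chartSimplex (p : M) {U : Set M} (hU : U ∈ 𝓝 p) :
    ∃ D : ChartSimplex n M, D.e = chartAt (PLHalfSpace n) p ∧ D.carrier ⊆ U ∧
      D.carrier ∈ 𝓝 p := by
  set e := chartAt (PLHalfSpace n) p with he
  have hp : p ∈ e.source := mem_chart_source (PLHalfSpace n) p
  have hW : e.target ∩ e.symm ⁻¹' U ∈ 𝓝 (e p) := by
    refine inter_mem (e.open_target.mem_nhds (e.map_source hp)) ?_
    refine (e.continuousAt_symm (e.map_source hp)).preimage_mem_nhds ?_
    rwa [e.left_inv hp]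
  rw [(PLHalfSpace.isInducing_incl n).nhds_eq_comap, mem_comap] at hW
  obtain ⟨V, hV, hVW⟩ := hW
  obtain ⟨S, hSV, hS⟩ := exists_simplex_subset (e p).incl_mem hV
  refine ⟨⟨e, S, fun x hx => ?_⟩, rfl, ?_, ?_⟩
  · have h := hSV hx
    refine ⟨⟨x, h.2⟩, (hVW (?_ : PLHalfSpace.incl (⟨x, h.2⟩ : PLHalfSpace n) ∈ V)).1, rfl⟩
    exact h.1
  · rintro q ⟨hq, hqS⟩
    have h : e q ∈ e.target ∩ e.symm ⁻¹' U := hVW (hSV hqS).1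
    have h2 := h.2
    rwa [mem_preimage, e.left_inv hq] at h2
  · have h1 : PLHalfSpace.incl ⁻¹' S.carrier ∈ 𝓝 (e p) := by
      obtain ⟨V', hV', h⟩ := mem_nhdsWithin_iff_exists_mem_nhds_inter.1 hS
      filter_upwards [PLHalfSpace.continuous_incl.continuousAt.preimage_mem_nhds hV'] with y hy
      exact h ⟨hy, y.incl_mem⟩
    filter_upwards [e.open_source.mem_nhds hp, (e.continuousAt hp).preimage_mem_nhds h1]
      with q hq hqS
    exact ⟨hq, hqS⟩

variable [MeasurableSpace M] [BorelSpace M]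

/-- In coordinates, a simplicial measure is locally the pullback of the volume by finitely many
affine maps. -/
theorem IsSimplicialMeasure.exists_affine {μ : Measure M} (hμ : IsSimplicialMeasure n μ) (p : M) :
    ∃ Q : Set (Set (EuclideanSpace ℝ (Fin n)) ×
        (EuclideanSpace ℝ (Fin n) →ᵃ[ℝ] EuclideanSpace ℝ (Fin n))), Q.Finite ∧
      (∀ q ∈ Q, IsConvexPolyhedron q.1) ∧ ∃ U ∈ 𝓝 p, (∀ y ∈ U, ∃ q ∈ Q, plCoord n p y ∈ q.1) ∧
      ∀ q ∈ Q, ∀ B, MeasurableSet B → B ⊆ U → (∀ y ∈ B, plCoord n p y ∈ q.1) →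
        μ B = volume (q.2 '' (plCoord n p '' B)) ∧ InjOn q.2 (plCoord n p '' B) := by
  obtain ⟨T, hT⟩ := hμ
  choose! A hAi hA using hT
  obtain ⟨Q, hQ, hQP, hQe⟩ := T.isPL_symm p
  obtain ⟨U, hU, hUQ⟩ := hQe.exists_mem
  -- One piece for each affine piece `q` of the inverse triangulation in coordinates and each
  -- simplex `s`: the part of `q` mapped into `s`, with the affine map of `q` followed by that of
  -- `s`.
  refine ⟨(fun r : (Set (EuclideanSpace ℝ (Fin n)) ×
      (EuclideanSpace ℝ (Fin n) →ᵃ[ℝ] EuclideanSpace ℝ (Fin T.N))) ×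
      Finset (EuclideanSpace ℝ (Fin T.N)) =>
      (r.1.1 ∩ r.1.2 ⁻¹' convexHull ℝ (r.2 : Set _), (A r.2).comp r.1.2)) '' (Q ×ˢ T.K.faces),
    (hQ.prod T.finite_faces).image _, ?_, U, hU, fun y hy => ?_, ?_⟩
  · rintro _ ⟨⟨q, s⟩, ⟨hq, hs⟩, rfl⟩
    exact (hQP q hq).inter ((isConvexPolyhedron_convexHull (T.K.indep hs)).preimage q.2)
  · obtain ⟨⟨q, hq, hyq⟩, h2⟩ := hUQ y hy
    obtain ⟨s, hs, hys⟩ := mem_iUnion₂.1 (T.homeo.symm y).2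
    refine ⟨_, ⟨(q, s), ⟨hq, hs⟩, rfl⟩, hyq, ?_⟩
    rw [mem_preimage, ← h2 q hq hyq]
    exact hys
  · rintro _ ⟨⟨q, s⟩, ⟨hq, hs⟩, rfl⟩ B hB hBU hBP
    have e : ∀ y ∈ B, (T.homeo.symm y : EuclideanSpace ℝ (Fin T.N)) = q.2 (plCoord n p y) :=
      fun y hy => (hUQ y (hBU hy)).2 q hq (hBP y hy).1
    constructor
    · have h := hA s hs (T.homeo.symm '' B)
        (T.homeo.symm.measurableEmbedding.measurableSet_image.2 hB) (by
          rintro _ ⟨y, hy, rfl⟩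
          rw [e y hy]
          exact (hBP y hy).2)
      rw [image_image, image_image] at h
      simp only [Homeomorph.apply_symm_apply, image_id'] at h
      rw [h, image_image]
      congr 1
      refine image_congr fun y hy => ?_
      rw [e y hy]
      rfl
    · rintro _ ⟨y, hy, rfl⟩ _ ⟨z, hz, rfl⟩ hyz
      have h1 := hAi s hs (hBP y hy).2 (hBP z hz).2 hyz
      rw [← e y hy, ← e z hz] at h1
      rw [T.homeo.symm.injective (Subtype.val_injective h1)]

theorem IsSimplicialMeasure.hasPLDensityAt {μ : Measure M} (hμ : IsSimplicialMeasure n μ) (p : M) :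
    HasPLDensityAt (plCoord n p) μ p := by
  obtain ⟨Q, hQ, hQP, U, hU, hUQ, hd⟩ := hμ.exists_affine p
  refine ⟨(fun q : Set (EuclideanSpace ℝ (Fin n)) ×
      (EuclideanSpace ℝ (Fin n) →ᵃ[ℝ] EuclideanSpace ℝ (Fin n)) =>
      (q.1, (|LinearMap.det q.2.linear|).toNNReal)) '' Q, hQ.image _, ?_, U, hU,
      fun y hy => ?_, ?_⟩
  · rintro _ ⟨q, hq, rfl⟩
    exact hQP q hq
  · obtain ⟨q, hq, h⟩ := hUQ y hy
    exact ⟨_, ⟨q, hq, rfl⟩, h⟩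
  · rintro _ ⟨q, hq, rfl⟩ B hB hBU hBP
    rw [(hd q hq B hB hBU hBP).1, volume_image_affineMap]
    rfl

/-- A small chart simplex in a null open set is covered by finitely many affine pieces. A piece of
positive volume carries an injective, hence nondegenerate, affine map and so has positive measure;
thus all pieces would have zero volume. -/
theorem IsSimplicialMeasure.isOpenPosMeasure [T2Space M] {μ : Measure M}
    (hμ : IsSimplicialMeasure n μ) : μ.IsOpenPosMeasure := by
  refine ⟨fun O hO ⟨p, hp⟩ h0 => ?_⟩
  obtain ⟨Q, hQ, hQP, U, hU, hUQ, hd⟩ := hμ.exists_affine p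
  obtain ⟨D, hDe, hDU, -⟩ := exists_chartSimplex (n := n) p (inter_mem hU (hO.mem_nhds hp))
  have hco : plCoord n p = chartCoord D.e := by rw [hDe]; rfl
  rw [hco] at hUQ hd
  have hcov : D.S.carrier ⊆ ⋃ q ∈ Q, D.S.carrier ∩ q.1 := fun x hx => by
    obtain ⟨q, hq, h⟩ := hUQ _ (hDU (D.chartPoint_mem hx)).1
    rw [D.chartCoord_chartPoint hx] at h
    exact mem_biUnion hq ⟨hx, h⟩
  refine D.volume_carrier_pos.ne' (measure_mono_null hcov
    ((measure_biUnion_null_iff hQ.countable).2 fun q hq => ?_))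
  by_contra hne
  have hqm : MeasurableSet q.1 := (hQP q hq).isClosed.measurableSet
  have himg : chartCoord D.e '' (D.carrier ∩ chartCoord D.e ⁻¹' q.1) = D.S.carrier ∩ q.1 := by
    ext x
    constructor
    · rintro ⟨y, hy, rfl⟩
      exact ⟨hy.1.2, hy.2⟩
    · rintro ⟨hx, hxq⟩
      exact ⟨chartPoint D.e x, ⟨D.chartPoint_mem hx, by
        rwa [mem_preimage, D.chartCoord_chartPoint hx]⟩, D.chartCoord_chartPoint hx⟩
  obtain ⟨h1, h2⟩ := hd q hq _ (D.measurableSet_inter_preimage hqm)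
    (fun y hy => (hDU hy.1).1) fun y hy => hy.2
  rw [himg] at h1 h2
  have hdet := det_ne_zero_of_injOn q.2 (D.S.measurableSet_carrier.inter hqm) hne h2
  rw [measure_mono_null (fun y hy => (hDU hy.1).2) h0, volume_image_affineMap] at h1
  rcases mul_eq_zero.1 h1.symm with h | h
  · exact (ENNReal.ofReal_pos.2 (abs_pos.2 hdet)).ne' h
  · exact hne h

end Simplicial

/-! ### Exchanging mass between overlapping sets -/

section Exchange

variable {n : ℕ} {M : Type*} [TopologicalSpace M] [ChartedSpace (PLHalfSpace n) M]
  [MeasurableSpace M]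

variable (n) in
/-- The measure has everywhere a piecewise constant density in charts. -/
def HasPLDensity (μ : Measure M) : Prop := ∀ p, HasPLDensityAt (plCoord n p) μ p

theorem HasPLDensity.add {μ ν : Measure M} (hμ : HasPLDensity n μ) (hν : HasPLDensity n ν) :
    HasPLDensity n (μ + ν) := fun p => (hμ p).add (hν p)

theorem HasPLDensity.smul {μ : Measure M} (hμ : HasPLDensity n μ) (c : ℝ≥0) :
    HasPLDensity n (c • μ) := fun p => (hμ p).smul c

variable (n) in
/-- Restriction to `V` and to its complement preserves piecewise constant densities. -/
def PLMeasurable (V : Set M) : Prop :=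
  MeasurableSet V ∧ ∀ μ : Measure M, HasPLDensity n μ →
    HasPLDensity n (μ.restrict V) ∧ HasPLDensity n (μ.restrict Vᶜ)

theorem PLMeasurable.compl {V : Set M} (hV : PLMeasurable n V) : PLMeasurable n Vᶜ :=
  ⟨hV.1.compl, fun μ hμ => by rw [compl_compl]; exact (hV.2 μ hμ).symm⟩

theorem PLMeasurable.inter {V W : Set M} (hV : PLMeasurable n V) (hW : PLMeasurable n W) :
    PLMeasurable n (V ∩ W) := by
  refine ⟨hV.1.inter hW.1, fun μ hμ => ⟨?_, ?_⟩⟩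
  · rw [← Measure.restrict_restrict hV.1]
    exact (hV.2 _ (hW.2 μ hμ).1).1
  · have e : (V ∩ W)ᶜ = Wᶜ ∪ (Vᶜ ∩ W) := by
      ext x
      simp only [mem_compl_iff, mem_inter_iff, mem_union]
      tauto
    rw [e, Measure.restrict_union (disjoint_compl_left.mono_right inter_subset_right)
      (hV.1.compl.inter hW.1), ← Measure.restrict_restrict hV.1.compl]
    exact (hW.2 μ hμ).2.add (hV.2 _ (hW.2 μ hμ).1).2

theorem PLMeasurable.union {V W : Set M} (hV : PLMeasurable n V) (hW : PLMeasurable n W) :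
    PLMeasurable n (V ∪ W) := by
  rw [← compl_compl (V ∪ W), compl_union]
  exact (hV.compl.inter hW.compl).compl

variable [T2Space M] [BorelSpace M]

theorem ChartSimplex.plMeasurable [HasGroupoid M (plGroupoid n)] (D : ChartSimplex n M)
    (hD : D.e ∈ atlas (PLHalfSpace n) M) : PLMeasurable n D.carrier := by
  refine ⟨D.measurableSet_carrier, fun μ hμ => forall_and.1 fun p => ?_⟩
  by_cases hp : p ∈ D.e.source
  · have h1 := plAt_chartCoord (chart_mem_atlas (PLHalfSpace n) p) hD
      (mem_chart_source (PLHalfSpace n) p) hp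
    have h2 := plAt_chartCoord hD (chart_mem_atlas (PLHalfSpace n) p) hp
      (mem_chart_source (PLHalfSpace n) p)
    have h3 := ((hμ p).change_coord h2).restrict D.S D.measurableSet_carrier (by
      filter_upwards [D.e.open_source.mem_nhds hp] with q hq
      exact and_iff_right hq)
    exact ⟨h3.1.change_coord h1, h3.2.change_coord h1⟩
  · have hp' : p ∉ D.carrier := fun h => hp h.1
    have hn := D.isClosed_carrier.isOpen_compl.mem_nhds hp'
    refine ⟨HasPLDensityAt.zero.congr_measure hn fun B hB hBm => ?_,
      (hμ p).congr_measure hn fun B hB hBm => ?_⟩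
    · rw [Measure.restrict_apply hBm, (disjoint_compl_left.mono_left hB).inter_eq]
      simp
    · rw [Measure.restrict_apply hBm, inter_eq_left.2 hB]

variable (n) in
/-- Measures with positive piecewise constant densities which agree outside `V` and give `V` the
same mass are related by a PL homeomorphism. -/
def PLExchangeable (V : Set M) : Prop :=
  IsClosed V ∧ PLMeasurable n V ∧ ∀ μ ν : Measure M, [IsFiniteMeasure μ] → [IsFiniteMeasure ν] →
    [μ.IsOpenPosMeasure] → [ν.IsOpenPosMeasure] → HasPLDensity n μ → HasPLDensity n ν →
    μ.restrict Vᶜ = ν.restrict Vᶜ → μ V = ν V →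
      ∃ f : M ≃ₜ M, IsPLHomeomorph n f ∧ Measure.map f μ = ν

theorem ChartSimplex.plExchangeable [HasGroupoid M (plGroupoid n)] (D : ChartSimplex n M)
    (hD : D.e ∈ atlas (PLHalfSpace n) M) : PLExchangeable n D.carrier := by
  refine ⟨D.isClosed_carrier, D.plMeasurable hD, fun μ ν _ _ _ _ hμ hν hoff hmass => ?_⟩
  have h : ∀ ρ : Measure M, HasPLDensity n ρ → ∀ q ∈ D.carrier,
      HasPLDensityAt (chartCoord D.e) ρ q := fun ρ hρ q hq =>
    (hρ q).change_coord (plAt_chartCoord hD (chart_mem_atlas (PLHalfSpace n) q) hq.1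
      (mem_chart_source (PLHalfSpace n) q))
  exact D.exists_isPLHomeomorph hD (h μ hμ) (h ν hν) hoff hmass

theorem measure_eq_of_restrict_compl_eq {μ ν : Measure M} {V A : Set M}
    (h : μ.restrict Vᶜ = ν.restrict Vᶜ) (hA : MeasurableSet A) (hAV : A ⊆ Vᶜ) : μ A = ν A := by
  have := congrArg (fun ρ => ρ A) h
  simpa only [Measure.restrict_apply hA, inter_eq_left.2 hAV] using this

theorem PLExchangeable.exists_of_le {V W : Set M} (hV : PLExchangeable n V)
    (hW : PLExchangeable n W) {μ ν : Measure M} [IsFiniteMeasure μ] [IsFiniteMeasure ν]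
    [μ.IsOpenPosMeasure] [ν.IsOpenPosMeasure] (hμ : HasPLDensity n μ) (hν : HasPLDensity n ν)
    (hoff : μ.restrict (V ∪ W)ᶜ = ν.restrict (V ∪ W)ᶜ) (hmass : μ (V ∪ W) = ν (V ∪ W))
    (hI : μ (V ∩ W) ≠ 0) (hle : ν (W \ V) ≤ μ (W \ V)) :
    ∃ f : M ≃ₜ M, IsPLHomeomorph n f ∧ Measure.map f μ = ν := by
  obtain ⟨hVc, hVm, hVe⟩ := hV
  obtain ⟨hWc, hWm, hWe⟩ := hW
  have mV := hVm.1
  have mW := hWm.1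
  -- The intermediate measure is `μ` off `W`, already `ν` on `W \ V`, and `t` times `μ` on `V ∩ W`,
  -- with `t` chosen to keep the mass of `W`. The surplus moved into the overlap is nonnegative by
  -- `hle`, so `t ≥ 1` and positivity survives.
  set t : ℝ≥0∞ := 1 + (μ (W \ V) - ν (W \ V)) / μ (V ∩ W) with ht
  have ht_top : t ≠ ∞ := ENNReal.add_ne_top.2
    ⟨ENNReal.one_ne_top, ENNReal.div_ne_top (ENNReal.sub_ne_top (measure_ne_top _ _)) hI⟩
  have ht0 : t ≠ 0 := (lt_of_lt_of_le one_pos le_self_add).ne'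
  have htm : t * μ (V ∩ W) = μ (V ∩ W) + (μ (W \ V) - ν (W \ V)) := by
    rw [ht, add_mul, one_mul, ENNReal.div_mul_cancel hI (measure_ne_top _ _)]
  lift t to ℝ≥0 using ht_top with s hs
  set κ : Measure M := μ.restrict Wᶜ + (ν.restrict (W \ V) + s • μ.restrict (V ∩ W)) with hκ
  have κapp : ∀ B, MeasurableSet B → κ B = μ (B ∩ Wᶜ) + (ν (B ∩ (W \ V)) + s * μ (B ∩ (V ∩ W))) := by
    intro B hB
    simp only [hκ, Measure.add_apply, Measure.smul_apply, Measure.restrict_apply hB]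
    rfl
  have hκd : HasPLDensity n κ :=
    (hWm.2 μ hμ).2.add (((hWm.inter hVm.compl).2 ν hν).1.add (((hVm.inter hWm).2 μ hμ).1.smul s))
  have hκf : IsFiniteMeasure κ := by infer_instance
  -- A `κ`-null open set misses `Wᶜ` because `μ` is positive there, then misses `Vᶜ` because `ν` is,
  -- and so lies in `V ∩ W`, where `κ` is a positive multiple of `μ`.
  have hκo : κ.IsOpenPosMeasure := by
    refine ⟨fun U hU hne h0 => ?_⟩
    rw [κapp U hU.measurableSet] at h0
    simp only [add_eq_zero, mul_eq_zero] at h0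
    obtain ⟨h1, h2, h3⟩ := h0
    have e1 := (hU.inter hWc.isOpen_compl).measure_eq_zero_iff μ |>.1 h1
    have e2 : U ∩ Vᶜ = ∅ := by
      refine (hU.inter hVc.isOpen_compl).measure_eq_zero_iff ν |>.1 (measure_mono_null ?_ h2)
      refine fun x hx => ⟨hx.1, ?_, hx.2⟩
      by_contra hxW
      exact (e1 ▸ (⟨hx.1, hxW⟩ : x ∈ U ∩ Wᶜ) : x ∈ (∅ : Set M))
    have e3 : U ∩ (V ∩ W) = U := inter_eq_left.2 fun x hx => by
      constructor
      · by_contra hxV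
        exact (e2 ▸ (⟨hx, hxV⟩ : x ∈ U ∩ Vᶜ) : x ∈ (∅ : Set M))
      · by_contra hxW
        exact (e1 ▸ (⟨hx, hxW⟩ : x ∈ U ∩ Wᶜ) : x ∈ (∅ : Set M))
    rw [e3] at h3
    exact h3.elim (fun h => ht0 h) (hU.measure_ne_zero μ hne)
  have hsplitW : ∀ ρ : Measure M, ρ W = ρ (V ∩ W) + ρ (W \ V) := fun ρ => by
    rw [inter_comm, measure_inter_add_sdiff _ mV]
  -- first exchange, on `W`
  obtain ⟨f, hf, hfm⟩ := hWe μ κ hμ hκd (by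
      ext B hB
      rw [Measure.restrict_apply hB, Measure.restrict_apply hB, κapp _ (hB.inter mW.compl)]
      have e1 : B ∩ Wᶜ ∩ (W \ V) = ∅ := by ext x; simp; tauto
      have e2 : B ∩ Wᶜ ∩ (V ∩ W) = ∅ := by ext x; simp; tauto
      rw [e1, e2, inter_assoc, inter_self]
      simp) (by
      rw [κapp W mW, inter_compl_self, measure_empty, zero_add,
        inter_eq_right.2 sdiff_subset, inter_eq_right.2 inter_subset_right, htm, hsplitW μ,
        add_left_comm, add_tsub_cancel_of_le hle])
  -- second exchange, on `V`
  have hVV : κ.restrict Vᶜ = ν.restrict Vᶜ := by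
    ext B hB
    have hBV := hB.inter mV.compl
    rw [Measure.restrict_apply hB, Measure.restrict_apply hB, κapp _ hBV]
    have e2 : B ∩ Vᶜ ∩ (V ∩ W) = ∅ := by ext x; simp; tauto
    have e3 : B ∩ Vᶜ ∩ (W \ V) = B ∩ Vᶜ ∩ W := by ext x; simp; tauto
    rw [e2, e3, measure_empty, mul_zero, add_zero,
      measure_eq_of_restrict_compl_eq hoff (hBV.inter mW.compl)
        (fun x hx => by rw [compl_union]; exact ⟨hx.1.2, hx.2⟩),
      add_comm, ← Set.sdiff_eq (B ∩ Vᶜ) W, measure_inter_add_sdiff _ mW]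
  have huniv : κ univ = ν univ := by
    have h1 : κ univ = μ univ := by
      rw [← hfm, Measure.map_apply f.continuous.measurable MeasurableSet.univ, preimage_univ]
    rw [h1, ← measure_add_measure_compl (mV.union mW), ← measure_add_measure_compl (mV.union mW),
      hmass, measure_eq_of_restrict_compl_eq hoff (mV.union mW).compl subset_rfl]
  obtain ⟨g, hg, hgm⟩ := hVe κ ν hκd hν hVV (by
    have h1 := measure_compl mV.compl (measure_ne_top κ _)
    have h2 := measure_compl mV.compl (measure_ne_top ν _)
    rw [compl_compl] at h1 h2
    rw [h1, h2, huniv, measure_eq_of_restrict_compl_eq hVV mV.compl subset_rfl])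
  refine ⟨f.trans g, hf.trans hg, ?_⟩
  rw [← hgm, ← hfm, Measure.map_map g.continuous.measurable f.continuous.measurable]
  rfl

/-- The overlap has positive mass for both measures. Whichever has more mass on `W \ V` is taken as
the source; in the second case the resulting homeomorphism is inverted. -/
theorem PLExchangeable.union {V W : Set M} (hV : PLExchangeable n V) (hW : PLExchangeable n W)
    (hVW : (interior V ∩ interior W).Nonempty) : PLExchangeable n (V ∪ W) := by
  refine ⟨hV.1.union hW.1, hV.2.1.union hW.2.1, fun μ ν _ _ _ _ hμ hν hoff hmass => ?_⟩
  have hI : ∀ ρ : Measure M, [ρ.IsOpenPosMeasure] → ρ (V ∩ W) ≠ 0 := fun ρ _ h0 =>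
    (isOpen_interior.inter isOpen_interior).measure_ne_zero ρ hVW
      (measure_mono_null (inter_subset_inter interior_subset interior_subset) h0)
  rcases le_total (ν (W \ V)) (μ (W \ V)) with h | h
  · exact hV.exists_of_le hW hμ hν hoff hmass (hI μ) h
  · obtain ⟨f, hf, hfm⟩ := hV.exists_of_le hW hν hμ hoff.symm hmass.symm (hI ν) h
    refine ⟨f.symm, hf.symm, ?_⟩
    rw [← hfm, Measure.map_map f.symm.continuous.measurable f.continuous.measurable,
      Homeomorph.symm_comp_self, Measure.map_id]

variable [HasGroupoid M (plGroupoid n)] [CompactSpace M] [ConnectedSpace M]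

/-- Among subfamilies of a finite cover by simplices whose union is exchangeable, take one with the
most members. Were some left over, connectedness would make the interiors of a chosen and an
unchosen simplex meet, and the latter could be added. -/
theorem plExchangeable_univ : PLExchangeable n (univ : Set M) := by
  classical
  choose D hDe _ hDp using fun p : M => exists_chartSimplex (n := n) p univ_mem
  have hD : ∀ p, PLExchangeable n (D p).carrier := fun p =>
    (D p).plExchangeable (by rw [hDe]; exact chart_mem_atlas _ p)
  obtain ⟨t, ht⟩ := isCompact_univ.elim_nhds_subcover (fun p => interior (D p).carrier)
    fun p _ => interior_mem_nhds.2 (hDp p)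
  have hcov := ht.2
  obtain ⟨p₀⟩ := (inferInstance : Nonempty M)
  obtain ⟨q₀, hq₀, -⟩ := mem_iUnion₂.1 (hcov (mem_univ p₀))
  set 𝒮 := t.powerset.filter fun s => s.Nonempty ∧ PLExchangeable n (⋃ p ∈ s, (D p).carrier)
  obtain ⟨s, hs, hmax⟩ := 𝒮.exists_max_image Finset.card
    ⟨{q₀}, by simp [𝒮, hq₀, hD q₀]⟩
  simp only [𝒮, Finset.mem_filter, Finset.mem_powerset] at hs hmax
  obtain ⟨hst, hsne, hsE⟩ := hs
  have hO : ∀ u : Finset M, IsOpen (⋃ p ∈ u, interior (D p).carrier) := fun u =>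
    isOpen_biUnion fun p _ => isOpen_interior
  have hts : t \ s = ∅ := by
    by_contra hne
    obtain ⟨q₁, hq₁⟩ := Finset.nonempty_iff_ne_empty.2 hne
    obtain ⟨p₁, hp₁⟩ := hsne
    obtain ⟨x, -, hx1, hx2⟩ := isPreconnected_univ _ _ (hO s) (hO (t \ s)) (fun x hx => by
        obtain ⟨p, hp, hxp⟩ := mem_iUnion₂.1 (hcov hx)
        by_cases h : p ∈ s
        · exact Or.inl (mem_biUnion h hxp)
        · exact Or.inr (mem_biUnion (Finset.mem_sdiff.2 ⟨hp, h⟩) hxp))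
      ⟨p₁, mem_univ _, mem_biUnion hp₁ (mem_interior_iff_mem_nhds.2 (hDp p₁))⟩
      ⟨q₁, mem_univ _, mem_biUnion hq₁ (mem_interior_iff_mem_nhds.2 (hDp q₁))⟩
    obtain ⟨p, hp, hxp⟩ := mem_iUnion₂.1 hx1
    obtain ⟨q, hq, hxq⟩ := mem_iUnion₂.1 hx2
    obtain ⟨hqt, hqs⟩ := Finset.mem_sdiff.1 hq
    have hsub : (D p).carrier ⊆ ⋃ p ∈ s, (D p).carrier := 
      subset_biUnion_of_mem (u := fun p => (D p).carrier) hp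
    have hun := (hD q).union hsE ⟨x, hxq, interior_mono hsub hxp⟩
    have := hmax (insert q s) ⟨Finset.insert_subset hqt hst, Finset.insert_nonempty _ _, by
      rwa [Finset.set_biUnion_insert]⟩
    rw [Finset.card_insert_of_notMem hqs] at this
    omega
  have he : s = t := hst.antisymm (Finset.sdiff_eq_empty_iff_subset.1 hts)
  have hu : (⋃ p ∈ s, (D p).carrier) = univ := by
    rw [he, ← univ_subset_iff]
    exact hcov.trans (iUnion₂_mono fun p _ => interior_subset)
  rwa [hu] at hsE

/-- Finitely many constant densities on a compact simplex give a neighbourhood of finite mass;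
compactness does the rest. -/
theorem IsSimplicialMeasure.isFiniteMeasure {μ : Measure M} (hμ : IsSimplicialMeasure n μ) :
    IsFiniteMeasure μ := by
  have : IsLocallyFiniteMeasure μ := ⟨fun p => by
    obtain ⟨Q, hQ, hQP, U, hU, hUQ, hd⟩ := hμ.hasPLDensityAt p
    obtain ⟨D, hDe, hDU, hDp⟩ := exists_chartSimplex (n := n) p hU
    have hco : plCoord n p = chartCoord D.e := by rw [hDe]; rfl
    rw [hco] at hUQ hd
    refine ⟨D.carrier, hDp, ?_⟩
    have hcov : D.carrier ⊆ ⋃ q ∈ Q, D.carrier ∩ chartCoord D.e ⁻¹' q.1 := fun y hy => by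
      obtain ⟨q, hq, h⟩ := hUQ y (hDU hy)
      exact mem_biUnion hq ⟨hy, h⟩
    refine (measure_mono hcov).trans_lt (measure_biUnion_lt_top hQ fun q hq => ?_)
    rw [hd q hq _ (D.measurableSet_inter_preimage (hQP q hq).isClosed.measurableSet)
      (fun y hy => hDU hy.1) fun y hy => hy.2]
    refine ENNReal.mul_lt_top ENNReal.coe_lt_top (lt_of_le_of_lt (measure_mono ?_)
      D.S.isCompact_carrier.measure_lt_top)
    rintro _ ⟨y, hy, rfl⟩
    exact hy.1.2⟩
  infer_instance

theorem IsSimplicialMeasure.exists_isPLHomeomorph {μ₁ μ₂ : Measure M}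
    (h₁ : IsSimplicialMeasure n μ₁) (h₂ : IsSimplicialMeasure n μ₂) (h : μ₁ univ = μ₂ univ) :
    ∃ f : M ≃ₜ M, IsPLHomeomorph n f ∧ Measure.map f μ₁ = μ₂ := by
  have := h₁.isFiniteMeasure
  have := h₂.isFiniteMeasure
  have := h₁.isOpenPosMeasure
  have := h₂.isOpenPosMeasure
  exact plExchangeable_univ.2.2 μ₁ μ₂ h₁.hasPLDensityAt h₂.hasPLDensityAt (by simp) h

end Exchange

/-! ### Charts carrying the measure to Lebesgue measure -/

section LocalCharts

variable {n : ℕ}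

theorem isPLEquiv_smul {E : Type*} [NormedAddCommGroup E] [NormedSpace ℝ E] {r : ℝ} (hr : r ≠ 0) :
    IsPLEquiv (Homeomorph.smulOfNeZero r hr : E ≃ₜ E) :=
  ⟨fun _ => (PLAt.affine (ι := id) (r • LinearMap.id : E →ₗ[ℝ] E).toAffineMap).congr
      (Eventually.of_forall fun _ => rfl),
    fun _ => (PLAt.affine (ι := id) (r⁻¹ • LinearMap.id : E →ₗ[ℝ] E).toAffineMap).congr
      (Eventually.of_forall fun _ => rfl)⟩

/-- The homeomorphism of the half-space induced by a homeomorphism of `ℝⁿ` preserving it. -/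
def halfSpaceHomeomorph (k : EuclideanSpace ℝ (Fin n) ≃ₜ EuclideanSpace ℝ (Fin n))
    (hk : ∀ x, x ∈ PLHalfSpace.image n ↔ k x ∈ PLHalfSpace.image n) :
    PLHalfSpace n ≃ₜ PLHalfSpace n :=
  Homeomorph.subtype (p := (· ∈ PLHalfSpace.image n)) (q := (· ∈ PLHalfSpace.image n)) k hk

theorem halfSpaceHomeomorph_restr_mem
    {k : EuclideanSpace ℝ (Fin n) ≃ₜ EuclideanSpace ℝ (Fin n)} (hkpl : IsPLEquiv k)
    (hk : ∀ x, x ∈ PLHalfSpace.image n ↔ k x ∈ PLHalfSpace.image n) {O : Set (PLHalfSpace n)}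
    (hO : IsOpen O) :
    (halfSpaceHomeomorph k hk).toOpenPartialHomeomorph.restrOpen O hO ∈ plGroupoid n := by
  refine mem_groupoid_of_pregroupoid.2 ⟨fun x _ => ?_, fun x _ => ?_⟩
  · exact (hkpl.1 x.incl).comp_id (PLAt.self PLHalfSpace.incl x)
      PLHalfSpace.continuous_incl.continuousAt
  · exact (hkpl.2 x.incl).comp_id (PLAt.self PLHalfSpace.incl x)
      PLHalfSpace.continuous_incl.continuousAt

variable {M : Type*} [TopologicalSpace M] [ChartedSpace (PLHalfSpace n) M]
  [HasGroupoid M (plGroupoid n)]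

theorem trans_mem_maximalAtlas {e : OpenPartialHomeomorph M (PLHalfSpace n)}
    (he : e ∈ atlas (PLHalfSpace n) M)
    {h : OpenPartialHomeomorph (PLHalfSpace n) (PLHalfSpace n)} (hh : h ∈ plGroupoid n) :
    e.trans h ∈ (plGroupoid n).maximalAtlas M := by
  rw [mem_maximalAtlas_iff]
  intro e' he'
  constructor
  · rw [OpenPartialHomeomorph.trans_symm_eq_symm_trans_symm, OpenPartialHomeomorph.trans_assoc]
    exact (plGroupoid n).trans ((plGroupoid n).symm hh) (HasGroupoid.compatible he he')
  · rw [← OpenPartialHomeomorph.trans_assoc]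
    exact (plGroupoid n).trans (HasGroupoid.compatible he' he) hh

variable [T2Space M] [MeasurableSpace M] [BorelSpace M]

/-- In dimension 0 rescaling cannot change a density, but none is needed: every affine self-map of a
point has determinant 1. -/
theorem IsSimplicialMeasure.isLocallyPLLebesgue_of_zero {M : Type*} [TopologicalSpace M]
    [ChartedSpace (PLHalfSpace 0) M] [HasGroupoid M (plGroupoid 0)] [MeasurableSpace M]
    [BorelSpace M] {μ : Measure M} (hμ : IsSimplicialMeasure 0 μ) : IsLocallyPLLebesgue 0 μ := by
  intro p
  refine ⟨chartAt (PLHalfSpace 0) p, (plGroupoid 0).chart_mem_maximalAtlas p,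
    mem_chart_source (PLHalfSpace 0) p, fun B hB hBs => ?_⟩
  have hBp : ∀ q ∈ B, q = p := fun q hq =>
    injOn_chartCoord (chartAt (PLHalfSpace 0) p) (hBs hq) (mem_chart_source (PLHalfSpace 0) p)
      (Subsingleton.elim _ _)
  obtain ⟨Q, -, -, U, hU, hUQ, hd⟩ := hμ.exists_affine p
  obtain ⟨q, hq, hpq⟩ := hUQ p (mem_of_mem_nhds hU)
  rw [(hd q hq B hB (fun y hy => by rw [hBp y hy]; exact mem_of_mem_nhds hU)
    (fun y hy => by rw [hBp y hy]; exact hpq)).1, volume_image_affineMap,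
    LinearMap.det_eq_one_of_finrank_eq_zero (by simp)]
  rw [abs_one, ENNReal.ofReal_one, one_mul]
  rfl

theorem IsSimplicialMeasure.isLocallyPLLebesgue {μ : Measure M} (hμ : IsSimplicialMeasure n μ) :
    IsLocallyPLLebesgue n μ := by
  rcases Nat.eq_zero_or_pos n with rfl | hn
  · exact hμ.isLocallyPLLebesgue_of_zero
  intro p
  have := hμ.isOpenPosMeasure
  obtain ⟨D, hDe, -, hDp⟩ := exists_chartSimplex (n := n) p univ_mem
  have hD : D.e ∈ atlas (PLHalfSpace n) M := by rw [hDe]; exact chart_mem_atlas _ p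
  obtain ⟨c, g, hc, hg, hoff, hmap⟩ := D.flattens μ fun q hq =>
    (hμ.hasPLDensityAt q).change_coord (plAt_chartCoord hD (chart_mem_atlas (PLHalfSpace n) q) hq.1
      (mem_chart_source (PLHalfSpace n) q))
  have hgS := Homeomorph.image_eq_of_eq_off hoff
  -- Scaling by `r` multiplies volume by `r ^ n = c`, absorbing the constant density. Being a
  -- positive homothety about the origin, it preserves the half-space.
  set r : ℝ := c ^ ((n : ℝ)⁻¹) with hr
  have hr0 : 0 < r := Real.rpow_pos_of_pos hc _
  have hrn : r ^ n = c := Real.rpow_inv_natCast_pow hc.le hn.ne'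
  set k := g.trans (Homeomorph.smulOfNeZero r hr0.ne') with hk
  have hkpl : IsPLEquiv k := hg.trans (isPLEquiv_smul hr0.ne')
  have himg : D.S.carrier ⊆ PLHalfSpace.image n := fun y hy => by
    obtain ⟨z, -, rfl⟩ := D.carrier_subset hy
    exact z.incl_mem
  have hk_iff : ∀ x, x ∈ PLHalfSpace.image n ↔ k x ∈ PLHalfSpace.image n := by
    intro x
    have h1 : k x ∈ PLHalfSpace.image n ↔ g x ∈ PLHalfSpace.image n :=
      forall₂_congr fun i _ => mul_nonneg_iff_of_pos_left hr0
    rw [h1]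
    by_cases hx : x ∈ D.S.carrier
    · have : g x ∈ D.S.carrier := hgS ▸ mem_image_of_mem g hx
      exact iff_of_true (himg hx) (himg this)
    · rw [hoff x hx]
  -- The chart is cut down to the interior of the simplex, since the density is constant only there.
  -- This interior is taken in `M`, so boundary points of `M` are allowed.
  have hO : IsOpen (D.e.target ∩ D.e.symm ⁻¹' interior D.carrier) :=
    D.e.symm.isOpen_inter_preimage isOpen_interior
  have hp : p ∈ D.e.source := by rw [hDe]; exact mem_chart_source (PLHalfSpace n) p
  refine ⟨_, trans_mem_maximalAtlas hD (halfSpaceHomeomorph_restr_mem hkpl hk_iff hO), ?_,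
    fun B hB hBs => ?_⟩
  · simp [hp, mem_interior_iff_mem_nhds.2 hDp]
  · have hBD : B ⊆ D.carrier := fun q hq => by
      have h := hBs hq
      simp only [OpenPartialHomeomorph.trans_source, mem_inter_iff, mem_preimage,
        OpenPartialHomeomorph.restrOpen_source] at h
      have h2 := h.2.2.2
      rw [D.e.left_inv h.1] at h2
      exact interior_subset h2
    obtain ⟨hm, hμB⟩ := D.pushed_apply_image μ hB hBD
    have e : (fun q => ((D.e.trans ((halfSpaceHomeomorph k hk_iff).toOpenPartialHomeomorph.restrOpen
        _ hO)) q).incl) '' B = r • (g '' (chartCoord D.e '' B)) := by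
      rw [← image_smul, image_image, image_image]
      rfl
    have hsub : chartCoord D.e '' B ⊆ D.S.carrier := by
      rintro _ ⟨q, hq, rfl⟩
      exact (hBD hq).2
    have hgm := g.measurableEmbedding.measurableSet_image.2 hm
    have h := congrArg (fun ν => ν (g '' (chartCoord D.e '' B))) hmap
    simp only [Measure.smul_apply, smul_eq_mul] at h
    rw [Measure.map_apply g.continuous.measurable hgm, g.preimage_image,
      Measure.restrict_apply hm, Measure.restrict_apply hgm, inter_eq_left.2 hsub,
      inter_eq_left.2 (by rw [← hgS]; exact image_mono hsub), hμB] at h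
    rw [e, Measure.addHaar_smul, h, finrank_euclideanSpace_fin, hrn, abs_of_pos hc]

end LocalCharts

theorem mainTheorem4 (n : ℕ) (M : Type*) [TopologicalSpace M] [ChartedSpace (PLHalfSpace n) M]
    [HasGroupoid M (plGroupoid n)] [T2Space M] [CompactSpace M] [ConnectedSpace M]
    [MeasurableSpace M] [BorelSpace M] :
    (∀ μ₁ μ₂ : Measure M, IsSimplicialMeasure n μ₁ → IsSimplicialMeasure n μ₂ →
      μ₁ Set.univ = μ₂ Set.univ →
        ∃ f : M ≃ₜ M, IsPLHomeomorph n f ∧ Measure.map f μ₁ = μ₂) ∧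
    ∀ μ : Measure M, IsSimplicialMeasure n μ → IsLocallyPLLebesgue n μ :=
  ⟨fun _ _ h₁ h₂ h => h₁.exists_isPLHomeomorph h₂ h, fun _ hμ => hμ.isLocallyPLLebesgue⟩
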